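/- For points $z_1,\dots,z_n\in\mathbb C$ put $\Delta(z_1,\dots,z_n)=\prod_{i\neq j}|z_i-z_j|$ (product over ordered pairs), and for $n\ge 2$ let $\Delta_{\max}=\Delta_{\max}(n)$ be the largest value of $\Delta$ over all $n$-tuples of points in the plane with diameter $\max_{i,j}|z_i-z_j|=2$ (this maximum is attained). Let $$I:=\int_0^{2\pi}\int_0^{2\pi}\frac{\left(\left(1-\frac{x}{\pi}\right)e^{ix/2}-\left(1-\frac{y}{\pi}\right)e^{iy/2}\right)^2\left(e^{ix}+e^{iy}\right)}{\left(e^{ix}-e^{iy}\right)^2}\,dx\,dy,\qquad C:=\exp\left(-\frac{I\pi^2}{128}\right).$$ The integrand is integrable on $[0,2\pi]^2$, the number $I$ is real and negative with $I\approx-0.481436$, and $C\approx 1.0378>1$ (both approximations correct to the displayed digits). Moreover $$\liminf_{\substack{n\to\infty\\ n\text{ even}}}\frac{\Delta_{\max}(n)}{n^n}\ \ge\ C .$$ In fact there is an explicit construction for each even $n\ge 2$: for real $c$ and $0\le k<n/2$ put $$\delta_k=c\left(\frac1n-\frac{4k}{n^2}\right),\qquad z_k=(1+\delta_k)e^{2\pi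 ik/n},\qquad z_{k+n/2}=-(1-\delta_k)e^{2\pi ik/n}.$$ For even $n\ge 4$ there is a largest real number $c=c_{\max}(n)$ for which $z_0,\dots,z_{n-1}$ have diameter $2$; for $n=2$ every $c$ gives diameter $2$, and we set $c_{\max}(2)=0$. With $c=c_{\max}(n)$ the points $z_0,\dots,z_{n-1}$ have diameter $2$ and satisfy $$\Delta(z_0,\dots,z_{n-1})=C\,n^n\left(1+O\left(\frac1n\right)\right)\qquad(n\text{ even}),$$ with an absolute implied constant. -/

import Mathlib

open Filter Topology MeasureTheory

noncomputable section

namespace DiameterTwo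

/-- `Δ(z) = ∏_{i ≠ j} |z i - z j|`, the product over ordered pairs of distinct indices. -/
def Delta {n : ℕ} (z : Fin n → ℂ) : ℝ :=
  ∏ p ∈ (Finset.univ : Finset (Fin n)).offDiag, ‖z p.1 - z p.2‖

/-- The values of `Δ` on the `n`-point configurations of diameter `2`. -/
def deltaValues (n : ℕ) : Set ℝ :=
  {d | ∃ z : Fin n → ℂ, Metric.diam (Set.range z) = 2 ∧ Delta z = d}

/-- The largest value of `Δ` over `n` points in the plane of diameter `2`. -/
def deltaMax (n : ℕ) : ℝ := sSup (deltaValues n)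

/-- The integrand of the double integral `I`. -/
def integrand (x y : ℝ) : ℂ :=
  ((1 - (x : ℂ) / (Real.pi : ℂ)) * Complex.exp (Complex.I * (x : ℂ) / 2)
      - (1 - (y : ℂ) / (Real.pi : ℂ)) * Complex.exp (Complex.I * (y : ℂ) / 2)) ^ 2
    * (Complex.exp (Complex.I * (x : ℂ)) + Complex.exp (Complex.I * (y : ℂ)))
    / (Complex.exp (Complex.I * (x : ℂ)) - Complex.exp (Complex.I * (y : ℂ))) ^ 2

/-- The double integral `I` over `[0, 2π]²`. -/
def doubleIntegral : ℂ :=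
  ∫ y in (0 : ℝ)..(2 * Real.pi), ∫ x in (0 : ℝ)..(2 * Real.pi), integrand x y

/-- The constant `C = exp (-I π² / 128)` (`I` is a real number). -/
def constC : ℝ := Real.exp (-doubleIntegral.re * (Real.pi ^ 2 / 128))

/-- The push amount `δ_k = c (1/n - 4k/n²)`. -/
def push (n : ℕ) (c : ℝ) (k : ℕ) : ℝ := c * (1 / (n : ℝ) - 4 * (k : ℝ) / (n : ℝ) ^ 2)

/-- The root of unity `e^{2πik/n}`. -/
def rootOfUnity (n k : ℕ) : ℂ :=
  Complex.exp (2 * (Real.pi : ℂ) * Complex.I * (k : ℂ) / (n : ℂ))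

/-- The configuration (for even `n`): `z_k = (1 + δ_k) e^{2πik/n}` and
`z_{k + n/2} = -(1 - δ_k) e^{2πik/n}` for `0 ≤ k < n/2`. -/
def config (n : ℕ) (c : ℝ) (j : Fin n) : ℂ :=
  if (j : ℕ) < n / 2 then
    ((1 + push n c j : ℝ) : ℂ) * rootOfUnity n j
  else
    -((1 - push n c ((j : ℕ) - n / 2) : ℝ) : ℂ) * rootOfUnity n ((j : ℕ) - n / 2)

/-- The parameters `c` for which the configuration has diameter `2`. -/
def admissible (n : ℕ) : Set ℝ := {c | Metric.diam (Set.range (config n c)) = 2}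

/-- The largest `c` for which the configuration has diameter `2`. (For `n = 2` every `c` is
admissible, and `cMax 2 = 0`.) -/
def cMax (n : ℕ) : ℝ := sSup (admissible n)

end DiameterTwo

end

/-!
The points are `z_j = (1 + δ_j) ω^j` with `ω = e^{2πi/n}` and a triangle wave `δ` of size `c/n`.

*Diameter.* Antipodal pairs stay at distance exactly `2`, and for any other pair, with
`φ = π(i - j)/n`, `|z_i - z_j|² = (δ_i - δ_j)² cos² φ + (2 + δ_i + δ_j)² sin² φ`. The binding pairs
are next to antipodal: one of them bounds `c` above, a Lipschitz estimate for `δ` shows that a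
slightly smaller `c` is admissible, and so the largest `c` is `π²/4 + O(1/n²)` (`abs_cMax_sub_le`).

*Asymptotics.* The regular polygon has `Δ = n^n`, and `|z_i - z_j| = |ω^i - ω^j| |1 + w_ij|` with
`w_ij = O(1/n)`. In the expansion of `∑ log |1 + w_ij|` the linear terms cancel, the cubic ones add
up to `O(1/n)`, and the quadratic ones are `(1/8) ∑ (δ_i - δ_j)²/sin² φ` minus a multiple of `∑ δ²`
(`sum_second_order`). The first sum is a sum of squared divided differences of the trigonometric
polynomial interpolating `δ`, so Parseval's identity diagonalizes it (`sum_norm_sq_quotient`). The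
Fourier coefficients of the triangle wave are explicit, which leaves a sum over odd `q < n` that
tends to a multiple of `∑ 1/q³` over odd `q` (`spectral_sum_approx`).

*The integral.* The integrand is bounded by `1`. Integrating along the lines `x - y = t` leaves one
variable, where the integrand is a polynomial times a trigonometric function with double poles;
integration by parts and the Riemann–Lebesgue lemma evaluate it as
`I = 4π²/3 - (128/π²) ∑ 1/q³` (`doubleIntegral_eq`). Hence `C = exp (∑ 1/q³ - π⁴/96)`, which is the
limit found above, and the numerical claims follow from telescoping bounds for the series.
-/

namespace DiameterTwo

/-! ### Extremal configurations exist -/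

/-- A nonempty finite family has diameter `d` exactly when `d` bounds all distances and is attained
by some pair. -/
theorem diam_range_eq_iff {n : ℕ} (hn : 0 < n) (z : Fin n → ℂ) (d : ℝ) :
    Metric.diam (Set.range z) = d ↔
      (∀ i j, dist (z i) (z j) ≤ d) ∧ ∃ i j, dist (z i) (z j) = d := by
  have : Nonempty (Fin n) := ⟨⟨0, hn⟩⟩
  have hb : Bornology.IsBounded (Set.range z) := (Set.finite_range z).isBounded
  constructor
  · rintro rfl
    refine ⟨fun i j => Metric.dist_le_diam_of_mem hb ⟨i, rfl⟩ ⟨j, rfl⟩, ?_⟩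
    obtain ⟨p, hp⟩ := Finite.exists_max fun p : Fin n × Fin n => dist (z p.1) (z p.2)
    refine ⟨p.1, p.2, le_antisymm (Metric.dist_le_diam_of_mem hb ⟨_, rfl⟩ ⟨_, rfl⟩) ?_⟩
    apply Metric.diam_le_of_forall_dist_le dist_nonneg
    rintro _ ⟨i, rfl⟩ _ ⟨j, rfl⟩
    exact hp (i, j)
  · rintro ⟨h, i, j, hij⟩
    apply le_antisymm
    · apply Metric.diam_le_of_forall_dist_le (hij ▸ dist_nonneg)
      rintro _ ⟨i, rfl⟩ _ ⟨j, rfl⟩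
      exact h i j
    · exact hij ▸ Metric.dist_le_diam_of_mem hb ⟨_, rfl⟩ ⟨_, rfl⟩

theorem continuous_Delta (n : ℕ) : Continuous (Delta : (Fin n → ℂ) → ℝ) := by
  unfold Delta
  fun_prop

theorem Delta_sub_const {n : ℕ} (z : Fin n → ℂ) (w : ℂ) :
    Delta (fun i => z i - w) = Delta z := by
  simp [Delta]

theorem isClosed_dist_conditions (n : ℕ) :
    IsClosed {z : Fin n → ℂ |
      (∀ i j, dist (z i) (z j) ≤ 2) ∧ ∃ i j, dist (z i) (z j) = 2} := by
  have h1 : IsClosed {z : Fin n → ℂ | ∀ i j, dist (z i) (z j) ≤ 2} := by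
    simp only [Set.ofPred_forall]
    exact isClosed_iInter fun i => isClosed_iInter fun j =>
      isClosed_le (by fun_prop) continuous_const
  have h2 : IsClosed {z : Fin n → ℂ | ∃ i j, dist (z i) (z j) = 2} := by
    simp only [Set.ofPred_exists]
    exact isClosed_iUnion_of_finite fun i => isClosed_iUnion_of_finite fun j =>
      isClosed_eq (by fun_prop) continuous_const
  exact h1.inter h2

theorem isGreatest_deltaMax {n : ℕ} (hn : 2 ≤ n) :
    IsGreatest (deltaValues n) (deltaMax n) := by
  have hn0 : 0 < n := by omega
  let o : Fin n := ⟨0, hn0⟩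
  -- By translation invariance the first point may be placed at the origin.
  let S : Set (Fin n → ℂ) := {z | z o = 0} ∩
    {z | (∀ i j, dist (z i) (z j) ≤ 2) ∧ ∃ i j, dist (z i) (z j) = 2}
  have hSc : IsClosed S :=
    (isClosed_eq (by fun_prop) continuous_const).inter (isClosed_dist_conditions n)
  have hSb : S ⊆ Metric.closedBall 0 2 := by
    rintro z ⟨hz0, hz, -⟩
    rw [mem_closedBall_zero_iff, pi_norm_le_iff_of_nonneg (by norm_num)]
    intro i
    have := hz i o
    rwa [show z o = 0 from hz0, dist_zero_right] at this
  have hS : IsCompact S := (isCompact_closedBall 0 2).of_isClosed_subset hSc hSb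
  have himg : deltaValues n = Delta '' S := by
    ext d
    constructor
    · rintro ⟨z, hz, rfl⟩
      refine ⟨fun i => z i - z o, ⟨sub_self _, ?_⟩, Delta_sub_const z _⟩
      simpa using (diam_range_eq_iff hn0 z 2).1 hz
    · rintro ⟨z, hz, rfl⟩
      exact ⟨z, (diam_range_eq_iff hn0 z 2).2 hz.2, rfl⟩
  have hne : S.Nonempty := by
    refine ⟨fun i => if i = o then 0 else 2, by simp, ?_, o, ⟨1, by omega⟩, ?_⟩
    · intro i j
      by_cases hi : i = o <;> by_cases hj : j = o <;> simp [hi, hj]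
    · have : (⟨1, by omega⟩ : Fin n) ≠ o := by simp [o, Fin.ext_iff]
      simp [this]
  rw [deltaMax, himg]
  exact (hS.image (continuous_Delta n)).isGreatest_sSup (hne.image _)

/-! ### The radial perturbation as a triangle wave -/

/-- The radial perturbation of the `j`-th point, as a function of a real index: the triangle wave
`(4c/n²)(|j - n/2| - n/4)`. It extends `push` to all of `0 ≤ j ≤ n`, with the sign change of
`config` on the second half absorbed. -/
noncomputable def wave (n : ℕ) (c j : ℝ) : ℝ := 4 * c / (n : ℝ) ^ 2 * (|j - n / 2| - n / 4)

/-- The primitive `n`-th root of unity `e^{2πi/n}`. -/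
noncomputable def zeta (n : ℕ) : ℂ := Complex.exp (2 * (Real.pi : ℂ) * Complex.I / (n : ℂ))

theorem zeta_isPrimitiveRoot {n : ℕ} (hn : n ≠ 0) : IsPrimitiveRoot (zeta n) n :=
  Complex.isPrimitiveRoot_exp n hn

theorem zeta_pow_eq (n k : ℕ) :
    zeta n ^ k = Complex.exp (((2 * Real.pi * k / n : ℝ) : ℂ) * Complex.I) := by
  rw [zeta, ← Complex.exp_nat_mul]
  congr 1
  push_cast
  ring

theorem norm_zeta_pow (n k : ℕ) : ‖zeta n ^ k‖ = 1 := by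
  rw [zeta_pow_eq, Complex.norm_exp_ofReal_mul_I]

theorem rootOfUnity_eq (n k : ℕ) : rootOfUnity n k = zeta n ^ k := by
  rw [rootOfUnity, zeta, ← Complex.exp_nat_mul]
  congr 1
  ring

theorem zeta_pow_half {m : ℕ} (hm : 0 < m) : zeta (m + m) ^ m = -1 := by
  have hm' : (m : ℝ) ≠ 0 := by positivity
  rw [zeta_pow_eq, show (2 * Real.pi * m / ((m + m : ℕ) : ℝ) : ℝ) = Real.pi by
    push_cast; field_simp; ring, Complex.exp_pi_mul_I]

theorem wave_left {m : ℕ} (hm : 0 < m) (c : ℝ) {k : ℝ} (hk : k ≤ m) :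
    wave (m + m) c k = c * (1 / ((m + m : ℕ) : ℝ) - 4 * k / ((m + m : ℕ) : ℝ) ^ 2) := by
  have hm' : (m : ℝ) ≠ 0 := by positivity
  rw [wave, abs_of_nonpos (by push_cast; linarith)]
  push_cast
  field_simp
  ring

theorem wave_right {m : ℕ} (c : ℝ) {k : ℝ} (hk : 0 ≤ k) (hk' : k ≤ m) :
    wave (m + m) c (k + m) = -wave (m + m) c k := by
  rw [wave, wave, abs_of_nonpos (a := k - _) (by push_cast; linarith),
    abs_of_nonneg (by push_cast; linarith)]
  push_cast
  ring

theorem config_eq {n : ℕ} (hn : Even n) (c : ℝ) (j : Fin n) :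
    config n c j = ((1 + wave n c (j : ℕ) : ℝ) : ℂ) * zeta n ^ (j : ℕ) := by
  obtain ⟨m, rfl⟩ := hn
  have hj := j.2
  have hm : 0 < m := by omega
  have h2 : (m + m) / 2 = m := by omega
  rw [config, h2]
  split_ifs with h
  · rw [rootOfUnity_eq, wave_left hm c (by exact_mod_cast h.le), push]
  · obtain ⟨k, hk⟩ : ∃ k : ℕ, (j : ℕ) = k + m := ⟨j - m, by omega⟩
    have hkm : (k : ℝ) ≤ m := by exact_mod_cast (by omega : k ≤ m)
    rw [hk, Nat.add_sub_cancel, Nat.cast_add, wave_right c (by positivity) hkm, wave_left hm c hkm,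
      rootOfUnity_eq, pow_add, zeta_pow_half hm, push]
    push_cast
    ring

theorem abs_wave_le {n : ℕ} {c x : ℝ} (hc : 0 ≤ c) (hx : 0 ≤ x) (hxn : x ≤ n) :
    |wave n c x| ≤ c / n := by
  rcases Nat.eq_zero_or_pos n with rfl | hn
  · simp [wave]
  have hn' : (0 : ℝ) < n := by exact_mod_cast hn
  have h : |(|x - n / 2| - n / 4)| ≤ (n : ℝ) / 4 := by
    rw [abs_le]
    constructor
    · linarith [abs_nonneg (x - n / 2)]
    · linarith [abs_le.2 (⟨by linarith, by linarith⟩ :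
        -((n : ℝ) / 2) ≤ x - n / 2 ∧ x - n / 2 ≤ n / 2)]
  rw [wave, abs_mul, abs_of_nonneg (by positivity)]
  calc 4 * c / (n : ℝ) ^ 2 * |(|x - n / 2| - n / 4)| ≤ 4 * c / (n : ℝ) ^ 2 * (n / 4) := by gcongr
    _ = c / n := by field_simp

theorem abs_wave_sub_le {n : ℕ} {c x y : ℝ} (hc : 0 ≤ c) :
    |wave n c x - wave n c y| ≤ 4 * c / (n : ℝ) ^ 2 * |x - y| := by
  rw [wave, wave, ← mul_sub, abs_mul, abs_of_nonneg (by positivity : 0 ≤ 4 * c / (n : ℝ) ^ 2)]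
  refine mul_le_mul_of_nonneg_left ?_ (by positivity)
  calc _ = |(|x - n / 2| - |y - n / 2|)| := by rw [sub_sub_sub_cancel_right]
    _ ≤ |x - n / 2 - (y - n / 2)| := abs_abs_sub_abs_le _ _
    _ = |x - y| := by congr 1; ring

/-- The Lipschitz bound for `wave` the other way round the circle. -/
theorem abs_wave_sub_le' {n : ℕ} {c x y : ℝ} (hc : 0 ≤ c) (hx : 0 ≤ x) (hxn : x ≤ n) (hy : 0 ≤ y)
    (hyn : y ≤ n) : |wave n c x - wave n c y| ≤ 4 * c / (n : ℝ) ^ 2 * (n - |x - y|) := by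
  rw [wave, wave, ← mul_sub, abs_mul, abs_of_nonneg (by positivity : 0 ≤ 4 * c / (n : ℝ) ^ 2)]
  refine mul_le_mul_of_nonneg_left ?_ (by positivity)
  rcases abs_cases (x - y) with h | h <;> rcases abs_cases (x - n / 2) with h1 | h1 <;>
    rcases abs_cases (y - n / 2) with h2 | h2 <;> rw [abs_le] <;> constructor <;> linarith

/-- The perturbations of two nearly antipodal points nearly cancel. -/
theorem abs_wave_add_le {n : ℕ} {c x y : ℝ} (hc : 0 ≤ c) (hx : 0 ≤ x) (hxn : x ≤ n) (hy : 0 ≤ y)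
    (hyn : y ≤ n) : |wave n c x + wave n c y| ≤ 4 * c / (n : ℝ) ^ 2 * |(|x - y|) - n / 2| := by
  rw [wave, wave, ← mul_add, abs_mul, abs_of_nonneg (by positivity : 0 ≤ 4 * c / (n : ℝ) ^ 2)]
  refine mul_le_mul_of_nonneg_left ?_ (by positivity)
  rcases abs_cases (x - y) with h | h <;> rcases abs_cases (x - n / 2) with h1 | h1 <;>
    rcases abs_cases (y - n / 2) with h2 | h2 <;>
    rcases abs_cases (|x - y| - n / 2) with h3 | h3 <;> rw [abs_le] <;> constructor <;> linarith

/-! ### Distances between the points of the configuration -/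

theorem norm_sq_polar_sub (a b α β : ℝ) :
    ‖(a : ℂ) * Complex.exp (α * Complex.I) - b * Complex.exp (β * Complex.I)‖ ^ 2 =
      (a - b) ^ 2 * Real.cos ((α - β) / 2) ^ 2 + (a + b) ^ 2 * Real.sin ((α - β) / 2) ^ 2 := by
  have h1 : Real.cos (α - β) = 2 * Real.cos ((α - β) / 2) ^ 2 - 1 := by
    rw [← Real.cos_two_mul]; congr 1; ring
  have h2 := Real.sin_sq_add_cos_sq ((α - β) / 2)
  rw [Real.cos_sub] at h1
  rw [← Complex.normSq_eq_norm_sq, Complex.normSq_apply]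
  simp only [Complex.sub_re, Complex.sub_im, Complex.re_ofReal_mul, Complex.im_ofReal_mul,
    Complex.exp_ofReal_mul_I_re, Complex.exp_ofReal_mul_I_im]
  have h3 := Real.sin_sq_add_cos_sq α
  have h4 := Real.sin_sq_add_cos_sq β
  linear_combination a ^ 2 * h3 + b ^ 2 * h4 - 2 * a * b * h1 - (a ^ 2 + b ^ 2 + 2 * a * b) * h2

theorem norm_sq_zeta_sub (n i j : ℕ) :
    ‖zeta n ^ i - zeta n ^ j‖ ^ 2 = 4 * Real.sin (Real.pi * ((i : ℝ) - j) / n) ^ 2 := by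
  have := norm_sq_polar_sub 1 1 (2 * Real.pi * i / n) (2 * Real.pi * j / n)
  rw [Complex.ofReal_one, one_mul, one_mul, ← zeta_pow_eq, ← zeta_pow_eq] at this
  rw [this, show (2 * Real.pi * i / n - 2 * Real.pi * j / n) / 2 = Real.pi * ((i : ℝ) - j) / n by ring]
  ring

theorem dist_sq_config {n : ℕ} (hn : Even n) (c : ℝ) (i j : Fin n) :
    dist (config n c i) (config n c j) ^ 2 =
      (wave n c (i : ℕ) - wave n c (j : ℕ)) ^ 2 *
          Real.cos (Real.pi * (((i : ℕ) : ℝ) - (j : ℕ)) / n) ^ 2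
        + (2 + (wave n c (i : ℕ) + wave n c (j : ℕ))) ^ 2 *
          Real.sin (Real.pi * (((i : ℕ) : ℝ) - (j : ℕ)) / n) ^ 2 := by
  rw [dist_eq_norm, config_eq hn, config_eq hn, zeta_pow_eq, zeta_pow_eq, norm_sq_polar_sub,
    show (2 * Real.pi * (i : ℕ) / n - 2 * Real.pi * (j : ℕ) / n) / 2 =
      Real.pi * (((i : ℕ) : ℝ) - (j : ℕ)) / n by ring]
  ring

theorem dist_config_antipodal {m : ℕ} (hm : 0 < m) (c : ℝ) :
    dist (config (m + m) c ⟨m, by omega⟩) (config (m + m) c ⟨0, by omega⟩) = 2 := by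
  have h := dist_sq_config ⟨m, rfl⟩ c (⟨m, by omega⟩ : Fin (m + m)) ⟨0, by omega⟩
  have hw : wave (m + m) c (m : ℕ) = -wave (m + m) c (0 : ℕ) := by
    have := wave_right (m := m) c le_rfl (by positivity)
    simpa using this
  have hm' : (m : ℝ) ≠ 0 := by positivity
  rw [hw, show Real.pi * (((m : ℕ) : ℝ) - ((0 : ℕ) : ℝ)) / ((m + m : ℕ) : ℝ) = Real.pi / 2 by
    push_cast; field_simp; ring] at h
  simp only [Real.cos_pi_div_two, Real.sin_pi_div_two] at h
  refine (sq_eq_sq₀ dist_nonneg (by norm_num)).1 ?_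
  rw [h]
  ring

/-! ### The largest admissible parameter -/

theorem mem_admissible_iff {m : ℕ} (hm : 0 < m) (c : ℝ) :
    c ∈ admissible (m + m) ↔
      ∀ i j, dist (config (m + m) c i) (config (m + m) c j) ≤ 2 := by
  change Metric.diam _ = 2 ↔ _
  rw [diam_range_eq_iff (by omega)]
  exact and_iff_left ⟨_, _, dist_config_antipodal hm c⟩

theorem isClosed_admissible {m : ℕ} (hm : 0 < m) : IsClosed (admissible (m + m)) := by
  have : admissible (m + m) =
      {c | ∀ i j, dist (config (m + m) c i) (config (m + m) c j) ≤ 2} := by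
    ext c
    exact mem_admissible_iff hm c
  rw [this]
  simp only [Set.ofPred_forall]
  refine isClosed_iInter fun i => isClosed_iInter fun j => isClosed_le ?_ continuous_const
  simp only [config_eq ⟨m, rfl⟩, wave]
  fun_prop

/-- The pair of points with indices `n/2 + 1` and `0` bounds the parameter from above. -/
theorem le_of_mem_admissible {m : ℕ} (hm : 2 ≤ m) {c : ℝ} (hc : c ∈ admissible (m + m)) :
    (1 + 2 * c / ((m + m : ℕ) : ℝ) ^ 2) * Real.cos (Real.pi / (m + m : ℕ)) ≤ 1 := by
  have h := (mem_admissible_iff (by omega) c).1 hc ⟨m + 1, by omega⟩ ⟨0, by omega⟩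
  have hm' : (0 : ℝ) < m := by positivity
  have hsq := dist_sq_config ⟨m, rfl⟩ c (⟨m + 1, by omega⟩ : Fin (m + m)) ⟨0, by omega⟩
  have hm1 : (1 : ℝ) ≤ m := by exact_mod_cast (by omega : 1 ≤ m)
  have hw : wave (m + m) c ((m + 1 : ℕ) : ℝ) + wave (m + m) c ((0 : ℕ) : ℝ)
      = 4 * c / ((m + m : ℕ) : ℝ) ^ 2 := by
    have := wave_right (m := m) c (k := 1) zero_le_one hm1
    rw [show ((m + 1 : ℕ) : ℝ) = 1 + m by push_cast; ring, this, wave_left (by omega) c hm1,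
      Nat.cast_zero, wave_left (by omega) c hm'.le]
    ring
  have hphi : Real.sin (Real.pi * (((m + 1 : ℕ) : ℝ) - ((0 : ℕ) : ℝ)) / ((m + m : ℕ) : ℝ))
      = Real.cos (Real.pi / (m + m : ℕ)) := by
    rw [← Real.sin_add_pi_div_two]
    congr 1
    push_cast
    field_simp
    ring
  simp only [hw, hphi] at hsq
  have h4 : dist (config (m + m) c ⟨m + 1, by omega⟩) (config (m + m) c ⟨0, by omega⟩) ^ 2 ≤ 4 := by
    nlinarith [dist_nonneg (x := config (m + m) c ⟨m + 1, by omega⟩)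
      (y := config (m + m) c ⟨0, by omega⟩)]
  rw [hsq] at h4
  refine abs_le_of_sq_le_sq' (b := 1) ?_ zero_le_one |>.2
  have : 0 ≤ (wave (m + m) c ((m + 1 : ℕ) : ℝ) - wave (m + m) c ((0 : ℕ) : ℝ)) ^ 2 *
    Real.cos (Real.pi * (((m + 1 : ℕ) : ℝ) - ((0 : ℕ) : ℝ)) / ((m + m : ℕ) : ℝ)) ^ 2 := by positivity
  rw [mul_pow]
  have e : (2 + 4 * c / ((m + m : ℕ) : ℝ) ^ 2) ^ 2 = 4 * (1 + 2 * c / ((m + m : ℕ) : ℝ) ^ 2) ^ 2 := by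
    ring
  rw [e] at h4
  linarith

theorem cos_pi_div_pos {n : ℕ} (hn : 4 ≤ n) : 0 < Real.cos (Real.pi / n) := by
  have hn' : (4 : ℝ) ≤ n := by exact_mod_cast hn
  apply Real.cos_pos_of_mem_Ioo
  constructor
  · have : 0 < Real.pi / n := by positivity
    linarith [Real.pi_pos]
  · rw [div_lt_div_iff₀ (by linarith) (by norm_num)]
    nlinarith [Real.pi_pos]

theorem bddAbove_admissible {m : ℕ} (hm : 2 ≤ m) : BddAbove (admissible (m + m)) := by
  have hpos := cos_pi_div_pos (n := m + m) (by omega)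
  have hm' : (0 : ℝ) < ((m + m : ℕ) : ℝ) ^ 2 := by positivity
  refine ⟨(1 / Real.cos (Real.pi / (m + m : ℕ))) * ((m + m : ℕ) : ℝ) ^ 2 / 2, fun c hc => ?_⟩
  have h := le_of_mem_admissible hm hc
  rw [← le_div_iff₀ hpos] at h
  have h2 : 2 * c / ((m + m : ℕ) : ℝ) ^ 2 ≤ 1 / Real.cos (Real.pi / (m + m : ℕ)) := by linarith
  rw [div_le_iff₀ hm'] at h2
  linarith

theorem mul_cos_le_sin {x : ℝ} (hx : 0 ≤ x) (hx' : x ≤ Real.pi / 2) :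
    x * Real.cos x ≤ Real.sin x := by
  rcases hx'.lt_or_eq with h1 | h1
  · have h2 := Real.le_tan hx h1
    have h3 : 0 < Real.cos x := Real.cos_pos_of_mem_Ioo ⟨by linarith [Real.pi_pos], h1⟩
    rwa [Real.tan_eq_sin_div_cos, le_div_iff₀ h3] at h2
  · rw [h1]; simp

/-- A sufficient condition for admissibility. After dividing by `cos² θ`, where `θ` measures how far
a pair of points is from being antipodal, it comes from `tan θ ≥ θ`. -/
theorem mem_admissible_of_le {m : ℕ} (hm : 2 ≤ m) {c : ℝ} (hc : 0 ≤ c)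
    (h : 16 * c + 16 * c ^ 2 / ((m + m : ℕ) : ℝ) ^ 2
      + 4 * c ^ 2 * Real.pi ^ 2 / ((m + m : ℕ) : ℝ) ^ 2 ≤ 4 * Real.pi ^ 2) :
    c ∈ admissible (m + m) := by
  rw [mem_admissible_iff (by omega)]
  obtain ⟨n, hn⟩ : ∃ n, n = m + m := ⟨_, rfl⟩
  rw [← hn] at h ⊢
  intro i j
  have hnm : (n : ℝ) / 2 = m := by rw [hn]; push_cast; ring
  have hnpos : (0 : ℝ) < n := by exact_mod_cast (by omega : 0 < n)
  have hi : ((i : ℕ) : ℝ) ≤ n := by exact_mod_cast i.2.le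
  have hj : ((j : ℕ) : ℝ) ≤ n := by exact_mod_cast j.2.le
  -- `r` is the combinatorial distance of the pair from an antipodal pair.
  obtain ⟨r, hr⟩ : ∃ r : ℕ, (r : ℝ) = |(|((i : ℕ) : ℝ) - (j : ℕ)|) - n / 2| := by
    refine ⟨(|(|((i : ℕ) : ℤ) - (j : ℕ)|) - m|).toNat, ?_⟩
    have : (((|(|((i : ℕ) : ℤ) - (j : ℕ)|) - m|).toNat : ℤ) : ℝ) =
        ((|(|((i : ℕ) : ℤ) - (j : ℕ)|) - m| : ℤ) : ℝ) := by
      rw [Int.toNat_of_nonneg (abs_nonneg _)]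
    rw [Int.cast_natCast] at this
    rw [this, hnm]
    push_cast
    rfl
  have hrm : (r : ℝ) ≤ n / 2 := by
    rw [hr, abs_le]
    have h0 := abs_nonneg (((i : ℕ) : ℝ) - (j : ℕ))
    have h1 : |((i : ℕ) : ℝ) - (j : ℕ)| ≤ n := by
      rw [abs_le]
      constructor <;> linarith [(Nat.cast_nonneg (i : ℕ) : (0 : ℝ) ≤ _),
        (Nat.cast_nonneg (j : ℕ) : (0 : ℝ) ≤ _)]
    constructor <;> linarith
  have hsq := dist_sq_config ⟨m, hn⟩ c i j
  have hs := abs_wave_add_le hc (Nat.cast_nonneg (i : ℕ)) hi (Nat.cast_nonneg (j : ℕ)) hj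
  rw [← hr] at hs
  have hd : |wave n c (i : ℕ) - wave n c (j : ℕ)| ≤ 2 * c / n := by
    have h1 := abs_wave_le hc (Nat.cast_nonneg (i : ℕ)) hi
    have h2 := abs_wave_le hc (Nat.cast_nonneg (j : ℕ)) hj
    calc _ ≤ |wave n c (i : ℕ)| + |wave n c (j : ℕ)| := abs_sub _ _
      _ ≤ c / n + c / n := add_le_add h1 h2
      _ = 2 * c / n := by ring
  set θ : ℝ := Real.pi * r / n with hθ
  have hsin : Real.sin (Real.pi * (((i : ℕ) : ℝ) - (j : ℕ)) / n) ^ 2 = Real.cos θ ^ 2 := by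
    rw [Real.sin_sq, Real.cos_sq, Real.cos_sq]
    have : Real.cos (2 * (Real.pi * (((i : ℕ) : ℝ) - (j : ℕ)) / n)) = -Real.cos (2 * θ) := by
      have e : Real.cos (2 * (Real.pi * (((i : ℕ) : ℝ) - (j : ℕ)) / n)) =
          Real.cos (2 * (Real.pi * |((i : ℕ) : ℝ) - (j : ℕ)| / n)) := by
        rcases abs_choice (((i : ℕ) : ℝ) - (j : ℕ)) with h1 | h1 <;> rw [h1]
        rw [← Real.cos_neg]; congr 1; ring
      have e2 : Real.cos (2 * θ) =
          Real.cos (2 * (Real.pi * (|((i : ℕ) : ℝ) - (j : ℕ)| - n / 2) / n)) := by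
        rw [hθ, hr]
        rcases abs_choice (|((i : ℕ) : ℝ) - (j : ℕ)| - n / 2) with h1 | h1 <;> rw [h1]
        rw [← Real.cos_neg]; congr 1; ring
      rw [e, e2, show 2 * (Real.pi * (|((i : ℕ) : ℝ) - (j : ℕ)| - n / 2) / n) =
        2 * (Real.pi * |((i : ℕ) : ℝ) - (j : ℕ)| / n) - Real.pi by field_simp, Real.cos_sub_pi,
        neg_neg]
    rw [this]
    ring
  have hcos : Real.cos (Real.pi * (((i : ℕ) : ℝ) - (j : ℕ)) / n) ^ 2 = Real.sin θ ^ 2 := by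
    rw [Real.cos_sq', hsin, Real.sin_sq]
  rw [hsin, hcos] at hsq
  refine abs_le_of_sq_le_sq' (b := 2) ?_ (by norm_num) |>.2
  rw [hsq]
  set η := wave n c (i : ℕ) + wave n c (j : ℕ)
  set σ := wave n c (i : ℕ) - wave n c (j : ℕ)
  have hθ0 : 0 ≤ θ := by positivity
  have hθ1 : θ ≤ Real.pi / 2 := by
    rw [hθ, div_le_iff₀ hnpos]
    nlinarith [Real.pi_pos]
  have htan := mul_cos_le_sin hθ0 hθ1
  have hc0 : 0 ≤ Real.cos θ := Real.cos_nonneg_of_mem_Icc ⟨by linarith [Real.pi_pos], hθ1⟩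
  have hσ : σ ^ 2 ≤ 4 * c ^ 2 / (n : ℝ) ^ 2 := by
    calc σ ^ 2 = |σ| ^ 2 := (sq_abs _).symm
      _ ≤ (2 * c / n) ^ 2 := by gcongr
      _ = _ := by ring
  have hη : 4 * η + η ^ 2 ≤ (4 - 4 * c ^ 2 / (n : ℝ) ^ 2) * θ ^ 2 := by
    have h1 : η ≤ 4 * c / (n : ℝ) ^ 2 * r := (le_abs_self _).trans hs
    have h2 : η ^ 2 ≤ (4 * c / (n : ℝ) ^ 2 * r) ^ 2 := by
      rw [← sq_abs]; gcongr
    have hrr : (r : ℝ) ≤ (r : ℝ) ^ 2 := by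
      exact_mod_cast Nat.le_self_pow two_ne_zero r
    have h3 : 4 * (4 * c / (n : ℝ) ^ 2 * r) ≤ 4 * (4 * c / (n : ℝ) ^ 2 * (r : ℝ) ^ 2) := by gcongr
    have h4 : 0 ≤ (4 * Real.pi ^ 2 - (16 * c + 16 * c ^ 2 / (n : ℝ) ^ 2
      + 4 * c ^ 2 * Real.pi ^ 2 / (n : ℝ) ^ 2)) * ((r : ℝ) ^ 2 / (n : ℝ) ^ 2) :=
      mul_nonneg (by linarith) (by positivity)
    have h5 : (4 - 4 * c ^ 2 / (n : ℝ) ^ 2) * θ ^ 2 - (4 * (4 * c / (n : ℝ) ^ 2 * (r : ℝ) ^ 2)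
      + (4 * c / (n : ℝ) ^ 2 * r) ^ 2) = (4 * Real.pi ^ 2 - (16 * c + 16 * c ^ 2 / (n : ℝ) ^ 2
      + 4 * c ^ 2 * Real.pi ^ 2 / (n : ℝ) ^ 2)) * ((r : ℝ) ^ 2 / (n : ℝ) ^ 2) := by
      rw [hθ]; ring
    linarith
  have hcoef : 0 ≤ 4 - 4 * c ^ 2 / (n : ℝ) ^ 2 := by
    have h1 : 4 * c ^ 2 * Real.pi ^ 2 / (n : ℝ) ^ 2 ≤ 4 * Real.pi ^ 2 := by
      have : 0 ≤ 16 * c + 16 * c ^ 2 / (n : ℝ) ^ 2 := by positivity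
      linarith
    have h2 : 4 * c ^ 2 / (n : ℝ) ^ 2 * Real.pi ^ 2 ≤ 4 * Real.pi ^ 2 := by
      calc _ = 4 * c ^ 2 * Real.pi ^ 2 / (n : ℝ) ^ 2 := by ring
        _ ≤ _ := h1
    have := le_of_mul_le_mul_right h2 (by positivity)
    linarith
  have hfin : (4 * η + η ^ 2) * Real.cos θ ^ 2 ≤ (4 - 4 * c ^ 2 / (n : ℝ) ^ 2) * Real.sin θ ^ 2 :=
    calc _ ≤ (4 - 4 * c ^ 2 / (n : ℝ) ^ 2) * θ ^ 2 * Real.cos θ ^ 2 := by gcongr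
      _ = (4 - 4 * c ^ 2 / (n : ℝ) ^ 2) * (θ * Real.cos θ) ^ 2 := by ring
      _ ≤ _ := by gcongr
  have hσ' : σ ^ 2 * Real.sin θ ^ 2 ≤ 4 * c ^ 2 / (n : ℝ) ^ 2 * Real.sin θ ^ 2 := by gcongr
  nlinarith [Real.sin_sq_add_cos_sq θ]

theorem pi_sq_lt : Real.pi ^ 2 < 10 := by nlinarith [Real.pi_lt_d2, Real.pi_pos]

theorem lt_pi_sq : 9 < Real.pi ^ 2 := by nlinarith [Real.pi_gt_three]

/-- Since `c ≤ 5/2` and `π² < 10`, the two quadratic terms of `mem_admissible_of_le` are at most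
`350/n²`, which the decrement of `16c` by `400/n²` absorbs. -/
theorem approx_mem_admissible {m : ℕ} (hm : 2 ≤ m) :
    Real.pi ^ 2 / 4 - 25 / ((m + m : ℕ) : ℝ) ^ 2 ∈ admissible (m + m) := by
  have hn : (16 : ℝ) ≤ ((m + m : ℕ) : ℝ) ^ 2 := by
    have : (4 : ℝ) ≤ ((m + m : ℕ) : ℝ) := by exact_mod_cast (by omega : 4 ≤ m + m)
    nlinarith
  set N := ((m + m : ℕ) : ℝ) ^ 2
  have h1 := pi_sq_lt
  have h2 := lt_pi_sq
  have hN : 25 / N ≤ 25 / 16 := by gcongr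
  have hN0 : 0 < 25 / N := by positivity
  have hc0 : 0 ≤ Real.pi ^ 2 / 4 - 25 / N := by linarith
  have hc1 : Real.pi ^ 2 / 4 - 25 / N ≤ 5 / 2 := by linarith
  have hc2 : (Real.pi ^ 2 / 4 - 25 / N) ^ 2 ≤ 25 / 4 := by nlinarith
  refine mem_admissible_of_le hm hc0 ?_
  have h3 : 16 * (Real.pi ^ 2 / 4 - 25 / N) ^ 2 / N ≤ 100 / N := by gcongr; linarith
  have h4 : 4 * (Real.pi ^ 2 / 4 - 25 / N) ^ 2 * Real.pi ^ 2 / N ≤ 250 / N := by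
    gcongr; nlinarith
  have e1 : 100 / N = 4 * (25 / N) := by ring
  have e2 : 250 / N = 10 * (25 / N) := by ring
  linarith

theorem isGreatest_cMax {n : ℕ} (hn : Even n) (h4 : 4 ≤ n) :
    IsGreatest (admissible n) (cMax n) := by
  obtain ⟨m, rfl⟩ := hn
  have hm : 2 ≤ m := by omega
  have hb := bddAbove_admissible hm
  exact ⟨(isClosed_admissible (by omega)).csSup_mem ⟨_, approx_mem_admissible hm⟩ hb,
    fun c hc => le_csSup hb hc⟩

theorem cMax_mem_admissible {n : ℕ} (hn : Even n) (h2 : 2 ≤ n) : cMax n ∈ admissible n := by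
  rcases (by have := hn.two_dvd; omega : n = 2 ∨ 4 ≤ n) with rfl | h4
  · rw [show (2 : ℕ) = 1 + 1 from rfl, mem_admissible_iff one_pos]
    have h := dist_config_antipodal one_pos (cMax (1 + 1))
    intro i j
    fin_cases i <;> fin_cases j
    · simp
    · rw [dist_comm]; exact h.le
    · exact h.le
    · simp
  · exact (isGreatest_cMax hn h4).1

/-- The extremal parameter converges to `π²/4` with an error `O(1/n²)`. -/
theorem abs_cMax_sub_le {n : ℕ} (hn : Even n) (h4 : 4 ≤ n) :
    |cMax n - Real.pi ^ 2 / 4| ≤ 50 / (n : ℝ) ^ 2 := by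
  have hg := isGreatest_cMax hn h4
  obtain ⟨m, rfl⟩ := hn
  have hm : 2 ≤ m := by omega
  have hlow := hg.2 (approx_mem_admissible hm)
  have hup := le_of_mem_admissible hm hg.1
  have hn4 : (4 : ℝ) ≤ ((m + m : ℕ) : ℝ) := by exact_mod_cast h4
  set n := ((m + m : ℕ) : ℝ)
  set c := cMax (m + m)
  have h1 := pi_sq_lt
  have hn2 : 16 ≤ n ^ 2 := by nlinarith
  have hN0 : 0 < 25 / n ^ 2 := by positivity
  have hN1 : 25 / n ^ 2 ≤ 25 / 16 := by gcongr
  have hc0 : 0 ≤ c := by linarith [lt_pi_sq]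
  have hcos := Real.one_sub_sq_div_two_le_cos (x := Real.pi / n)
  have h5 : (1 + 2 * c / n ^ 2) * (1 - (Real.pi / n) ^ 2 / 2) ≤ 1 :=
    (mul_le_mul_of_nonneg_left hcos (by positivity)).trans hup
  have h6 : 2 * c - Real.pi ^ 2 / 2 - c * Real.pi ^ 2 / n ^ 2 ≤ 0 := by
    have e : ((1 + 2 * c / n ^ 2) * (1 - (Real.pi / n) ^ 2 / 2) - 1) * n ^ 2
        = 2 * c - Real.pi ^ 2 / 2 - c * Real.pi ^ 2 / n ^ 2 := by
      field_simp
      ring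
    rw [← e]
    exact mul_nonpos_of_nonpos_of_nonneg (by linarith) (by positivity)
  have h7 : c * Real.pi ^ 2 / n ^ 2 ≤ c * 10 / n ^ 2 := by gcongr
  have h8 : c * 10 / n ^ 2 ≤ c * 10 / 16 := by gcongr
  have hc5 : c ≤ 5 := by linarith
  have h9 : c * 10 / n ^ 2 ≤ 5 * 10 / n ^ 2 := by gcongr
  have e1 : 5 * 10 / n ^ 2 = 2 * (25 / n ^ 2) := by ring
  have e2 : 50 / n ^ 2 = 2 * (25 / n ^ 2) := by ring
  rw [abs_le]
  constructor <;> linarith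

/-! ### Parseval's identity and the quadratic form of a divided difference -/

theorem conj_zeta_pow_mul_self (n k : ℕ) : (starRingEnd ℂ) (zeta n ^ k) * zeta n ^ k = 1 := by
  rw [← Complex.normSq_eq_conj_mul_self, Complex.normSq_eq_norm_sq, norm_zeta_pow]
  simp

theorem sum_zeta_pow_mul_conj {n : ℕ} {a b : ℕ} (ha : a < n) (hb : b < n) :
    ∑ i ∈ Finset.range n, zeta n ^ (i * a) * (starRingEnd ℂ) (zeta n ^ (i * b)) =
      if a = b then (n : ℂ) else 0 := by
  have hζ := zeta_isPrimitiveRoot (by omega : n ≠ 0)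
  have hterm : ∀ i, zeta n ^ (i * a) * (starRingEnd ℂ) (zeta n ^ (i * b)) =
      (zeta n ^ a * (starRingEnd ℂ) (zeta n ^ b)) ^ i := by
    intro i
    rw [mul_pow, ← map_pow, ← pow_mul, ← pow_mul, mul_comm a i, mul_comm b i]
  simp only [hterm]
  split_ifs with h
  · subst h
    rw [mul_comm, conj_zeta_pow_mul_self]
    simp
  · have hne : zeta n ^ a * (starRingEnd ℂ) (zeta n ^ b) ≠ 1 := by
      intro h1
      apply h
      apply hζ.pow_inj ha hb
      calc zeta n ^ a = zeta n ^ a * ((starRingEnd ℂ) (zeta n ^ b) * zeta n ^ b) := by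
            rw [conj_zeta_pow_mul_self, mul_one]
        _ = zeta n ^ b := by rw [← mul_assoc, h1, one_mul]
    rw [geom_sum_eq hne, mul_pow, ← map_pow, ← pow_mul, ← pow_mul, mul_comm a, mul_comm b, pow_mul,
      pow_mul, hζ.pow_eq_one]
    simp

/-- Parseval's identity for the discrete Fourier transform. -/
theorem sum_norm_sq_dft (n : ℕ) (f : ℕ → ℂ) :
    ∑ i ∈ Finset.range n, ‖∑ a ∈ Finset.range n, f a * zeta n ^ (i * a)‖ ^ 2 =
      n * ∑ a ∈ Finset.range n, ‖f a‖ ^ 2 := by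
  have key : ∑ i ∈ Finset.range n, (∑ a ∈ Finset.range n, f a * zeta n ^ (i * a)) *
      (starRingEnd ℂ) (∑ b ∈ Finset.range n, f b * zeta n ^ (i * b)) =
      n * ∑ a ∈ Finset.range n, f a * (starRingEnd ℂ) (f a) := by
    simp only [map_sum, Finset.sum_mul_sum, map_mul]
    rw [Finset.sum_comm, Finset.mul_sum]
    refine Finset.sum_congr rfl fun a ha => ?_
    rw [Finset.sum_comm]
    have : ∀ b ∈ Finset.range n, ∑ i ∈ Finset.range n, f a * zeta n ^ (i * a) *
        ((starRingEnd ℂ) (f b) * (starRingEnd ℂ) (zeta n ^ (i * b))) =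
        if a = b then n * (f a * (starRingEnd ℂ) (f b)) else 0 := by
      intro b hb
      calc _ = f a * (starRingEnd ℂ) (f b) * ∑ i ∈ Finset.range n,
            zeta n ^ (i * a) * (starRingEnd ℂ) (zeta n ^ (i * b)) := by
            rw [Finset.mul_sum]
            exact Finset.sum_congr rfl fun i _ => by ring
        _ = _ := by
            rw [sum_zeta_pow_mul_conj (Finset.mem_range.1 ha) (Finset.mem_range.1 hb)]
            split_ifs <;> ring
    rw [Finset.sum_congr rfl this, Finset.sum_ite_eq, if_pos ha]
  simp only [Complex.mul_conj, Complex.normSq_eq_norm_sq] at key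
  exact_mod_cast key

/-- Every function on `{0, …, n - 1}` is the trigonometric polynomial of its Fourier coefficients. -/
theorem dft_inversion {n : ℕ} (f : ℕ → ℂ) {j : ℕ} (hj : j < n) :
    ∑ q ∈ Finset.range n,
      ((n : ℂ)⁻¹ * ∑ k ∈ Finset.range n, f k * (starRingEnd ℂ) (zeta n ^ (k * q))) *
        zeta n ^ (j * q) = f j := by
  have hn : (n : ℂ) ≠ 0 := by exact_mod_cast (by omega : n ≠ 0)
  have : ∀ k ∈ Finset.range n, ∑ q ∈ Finset.range n,
      (n : ℂ)⁻¹ * (f k * (starRingEnd ℂ) (zeta n ^ (k * q))) * zeta n ^ (j * q) =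
      if j = k then f k else 0 := by
    intro k hk
    have h := sum_zeta_pow_mul_conj hj (Finset.mem_range.1 hk)
    calc _ = (n : ℂ)⁻¹ * f k * ∑ q ∈ Finset.range n,
          zeta n ^ (q * j) * (starRingEnd ℂ) (zeta n ^ (q * k)) := by
          rw [Finset.mul_sum]
          refine Finset.sum_congr rfl fun q _ => ?_
          rw [mul_comm k q, mul_comm j q]; ring
      _ = _ := by
          rw [h]
          split_ifs
          · field_simp
          · ring
  simp only [Finset.mul_sum, Finset.sum_mul]
  rw [Finset.sum_comm, Finset.sum_congr rfl this, Finset.sum_ite_eq, if_pos (Finset.mem_range.2 hj)]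

theorem sum_sum_if_add_lt {M : Type*} [AddCommMonoid M] (n : ℕ) (F : ℕ → ℕ → M) :
    ∑ a ∈ Finset.range n, ∑ b ∈ Finset.range n, (if a + b + 1 < n then F a (a + b + 1) else 0) =
      ∑ q ∈ Finset.range n, ∑ a ∈ Finset.range q, F a q := by
  have h1 : ∀ a ∈ Finset.range n,
      ∑ b ∈ Finset.range n, (if a + b + 1 < n then F a (a + b + 1) else 0) =
        ∑ q ∈ Finset.range n, if a < q then F a q else 0 := by
    intro a _
    rw [← Finset.sum_filter, ← Finset.sum_filter]
    refine Finset.sum_nbij' (fun b => a + b + 1) (fun q => q - 1 - a) ?_ ?_ ?_ ?_ ?_ <;>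
      intro x hx <;> simp only [Finset.mem_filter, Finset.mem_range] at hx ⊢ <;> omega
  have h2 : ∀ q ∈ Finset.range n,
      ∑ a ∈ Finset.range n, (if a < q then F a q else 0) = ∑ a ∈ Finset.range q, F a q := by
    intro q hq
    have hq' := Finset.mem_range.1 hq
    rw [← Finset.sum_filter]
    refine Finset.sum_congr ?_ fun _ _ => rfl
    ext a
    simp only [Finset.mem_filter, Finset.mem_range]
    omega
  rw [Finset.sum_congr rfl h1, Finset.sum_comm, Finset.sum_congr rfl h2]

/-- The divided difference of `∑ A_q z^q`, arranged by monomials `z^a w^b` with `a + b = q - 1`. -/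
theorem sum_divided_difference (n : ℕ) (A : ℕ → ℂ) (z w : ℂ) :
    (∑ a ∈ Finset.range n, (∑ b ∈ Finset.range n,
      (if a + b + 1 < n then A (a + b + 1) else 0) * w ^ b) * z ^ a) * (z - w) =
      ∑ q ∈ Finset.range n, A q * z ^ q - ∑ q ∈ Finset.range n, A q * w ^ q := by
  have h : ∑ a ∈ Finset.range n, (∑ b ∈ Finset.range n,
      (if a + b + 1 < n then A (a + b + 1) else 0) * w ^ b) * z ^ a =
      ∑ q ∈ Finset.range n, ∑ a ∈ Finset.range q, A q * (z ^ a * w ^ (q - 1 - a)) := by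
    rw [← sum_sum_if_add_lt]
    refine Finset.sum_congr rfl fun a _ => ?_
    rw [Finset.sum_mul]
    refine Finset.sum_congr rfl fun b _ => ?_
    rw [show a + b + 1 - 1 - a = b by omega]
    split_ifs <;> ring
  rw [h, Finset.sum_mul, ← Finset.sum_sub_distrib]
  refine Finset.sum_congr rfl fun q _ => ?_
  rw [← Finset.mul_sum, mul_assoc, (Commute.all z w).geom_sum₂_mul]
  ring

/-- On the diagonal the divided difference is the derivative. -/
theorem sum_divided_difference_self (n : ℕ) (A : ℕ → ℂ) (z : ℂ) :
    ∑ a ∈ Finset.range n, (∑ b ∈ Finset.range n,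
      (if a + b + 1 < n then A (a + b + 1) else 0) * z ^ b) * z ^ a =
      ∑ a ∈ Finset.range n, (if a + 1 < n then (a + 1 : ℂ) * A (a + 1) else 0) * z ^ a := by
  have h : ∑ a ∈ Finset.range n, (∑ b ∈ Finset.range n,
      (if a + b + 1 < n then A (a + b + 1) else 0) * z ^ b) * z ^ a =
      ∑ q ∈ Finset.range n, ∑ a ∈ Finset.range q, A q * z ^ (q - 1) := by
    rw [← sum_sum_if_add_lt n fun _ q => A q * z ^ (q - 1)]
    refine Finset.sum_congr rfl fun a _ => ?_
    rw [Finset.sum_mul]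
    refine Finset.sum_congr rfl fun b _ => ?_
    rw [Nat.add_sub_cancel, pow_add]
    split_ifs <;> ring
  rw [h]
  rcases n with _ | n
  · simp
  rw [Finset.sum_range_succ', Finset.sum_range_succ]
  simp only [Finset.sum_const, Finset.card_range, nsmul_eq_mul, Nat.add_sub_cancel]
  rw [if_neg (by omega)]
  simp only [Nat.cast_zero, zero_mul, add_zero]
  refine Finset.sum_congr rfl fun a ha => ?_
  rw [if_pos (by have := Finset.mem_range.1 ha; omega)]
  push_cast
  ring

/-- The characters diagonalize this quadratic form. Off the diagonal the quotient is `|Q|²` for the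
divided difference `Q(z, w)` of `∑ A_q z^q`. Parseval's identity in both variables gives
`n² ∑ q |A_q|²` for the full sum of `|Q|²`, and in one variable it gives `n ∑ q² |A_q|²` for the
diagonal part. -/
theorem sum_norm_sq_quotient (n : ℕ) (f A : ℕ → ℂ)
    (hf : ∀ j < n, f j = ∑ q ∈ Finset.range n, A q * zeta n ^ (j * q)) :
    ∑ i ∈ Finset.range n, ∑ j ∈ Finset.range n,
      (if i = j then 0 else ‖f i - f j‖ ^ 2 / ‖zeta n ^ i - zeta n ^ j‖ ^ 2) =
      n * ∑ q ∈ Finset.range n, (q : ℝ) * (n - q) * ‖A q‖ ^ 2 := by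
  rcases Nat.eq_zero_or_pos n with rfl | hn
  · simp
  have hζ := zeta_isPrimitiveRoot hn.ne'
  let C : ℕ → ℕ → ℂ := fun a b => if a + b + 1 < n then A (a + b + 1) else 0
  let Q : ℕ → ℕ → ℂ := fun i j =>
    ∑ a ∈ Finset.range n, (∑ b ∈ Finset.range n, C a b * zeta n ^ (j * b)) * zeta n ^ (i * a)
  have hfull : ∑ j ∈ Finset.range n, ∑ i ∈ Finset.range n, ‖Q i j‖ ^ 2 =
      n * (n * ∑ q ∈ Finset.range n, (q : ℝ) * ‖A q‖ ^ 2) := by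
    simp only [Q, sum_norm_sq_dft]
    rw [← Finset.mul_sum, Finset.sum_comm]
    simp only [sum_norm_sq_dft]
    rw [← Finset.mul_sum]
    congr 2
    have := sum_sum_if_add_lt n fun _ q => ‖A q‖ ^ 2
    simp only [Finset.sum_const, Finset.card_range, nsmul_eq_mul] at this
    rw [← this]
    refine Finset.sum_congr rfl fun a _ => Finset.sum_congr rfl fun b _ => ?_
    simp only [C]
    split_ifs <;> simp
  have hdiag : ∑ i ∈ Finset.range n, ‖Q i i‖ ^ 2 =
      n * ∑ q ∈ Finset.range n, (q : ℝ) ^ 2 * ‖A q‖ ^ 2 := by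
    have h1 : ∀ i, Q i i = ∑ a ∈ Finset.range n,
        (if a + 1 < n then (a + 1 : ℂ) * A (a + 1) else 0) * zeta n ^ (i * a) := by
      intro i
      have := sum_divided_difference_self n A (zeta n ^ i)
      simp only [← pow_mul] at this
      exact this
    simp only [h1, sum_norm_sq_dft]
    congr 1
    obtain ⟨k, rfl⟩ : ∃ k, n = k + 1 := ⟨n - 1, by omega⟩
    rw [Finset.sum_range_succ, Finset.sum_range_succ', if_neg (by omega)]
    simp only [norm_zero, Nat.cast_zero]
    norm_num only [zero_mul, add_zero]
    refine Finset.sum_congr rfl fun a ha => ?_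
    rw [if_pos (by have := Finset.mem_range.1 ha; omega), norm_mul, mul_pow]
    congr 2
    rw [show (a + 1 : ℂ) = ((a + 1 : ℕ) : ℂ) by push_cast; rfl, Complex.norm_natCast]
  have hterm : ∀ i ∈ Finset.range n, ∀ j ∈ Finset.range n,
      (if i = j then 0 else ‖f i - f j‖ ^ 2 / ‖zeta n ^ i - zeta n ^ j‖ ^ 2) =
        ‖Q i j‖ ^ 2 - if i = j then ‖Q i i‖ ^ 2 else 0 := by
    intro i hi j hj
    split_ifs with h
    · rw [h, sub_self]
    · have hne : zeta n ^ i - zeta n ^ j ≠ 0 := fun h0 =>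
        h (hζ.pow_inj (Finset.mem_range.1 hi) (Finset.mem_range.1 hj) (sub_eq_zero.1 h0))
      have hQ : Q i j * (zeta n ^ i - zeta n ^ j) = f i - f j := by
        have := sum_divided_difference n A (zeta n ^ i) (zeta n ^ j)
        simp only [← pow_mul] at this
        rw [hf i (Finset.mem_range.1 hi), hf j (Finset.mem_range.1 hj)]
        exact this
      rw [← hQ, norm_mul, mul_pow, mul_div_assoc, div_self (by positivity)]
      ring
  calc _ = ∑ i ∈ Finset.range n, ∑ j ∈ Finset.range n,
        (‖Q i j‖ ^ 2 - if i = j then ‖Q i i‖ ^ 2 else 0) :=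
        Finset.sum_congr rfl fun i hi => Finset.sum_congr rfl fun j hj => hterm i hi j hj
    _ = ∑ i ∈ Finset.range n, ∑ j ∈ Finset.range n, ‖Q i j‖ ^ 2
        - ∑ i ∈ Finset.range n, ‖Q i i‖ ^ 2 := by
        simp only [Finset.sum_sub_distrib]
        congr 1
        refine Finset.sum_congr rfl fun i hi => ?_
        rw [Finset.sum_ite_eq, if_pos hi]
    _ = _ := by
        rw [Finset.sum_comm, hfull, hdiag, ← mul_sub, Finset.mul_sum, ← Finset.sum_sub_distrib]
        congr 1
        exact Finset.sum_congr rfl fun q _ => by ring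

/-! ### Fourier coefficients of the triangle wave -/

/-- An antiperiodic sequence has no even Fourier coefficients, and its odd ones are twice those of
the first half. -/
theorem sum_antiperiodic {m : ℕ} (f : ℕ → ℂ) (hf : ∀ k < m, f (k + m) = -f k) (z : ℂ) :
    ∑ k ∈ Finset.range (m + m), f k * z ^ k = (1 - z ^ m) * ∑ k ∈ Finset.range m, f k * z ^ k := by
  rw [Finset.sum_range_add, Finset.mul_sum, ← Finset.sum_add_distrib]
  refine Finset.sum_congr rfl fun k hk => ?_
  rw [add_comm m k, hf k (Finset.mem_range.1 hk), pow_add]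
  ring

theorem sum_linear_mul_pow (m : ℕ) (z : ℂ) :
    (1 - z) ^ 2 * ∑ k ∈ Finset.range m, ((m : ℂ) - 2 * k) * z ^ k =
      m * (1 - z) * (1 + z ^ m) - 2 * z * (1 - z ^ m) := by
  have h : ∀ N M : ℕ, (1 - z) ^ 2 * ∑ k ∈ Finset.range N, ((M : ℂ) - 2 * k) * z ^ k =
      (1 - z) * (M - (M - 2 * N) * z ^ N) - 2 * z * (1 - z ^ N) := by
    intro N M
    induction N with
    | zero => simp
    | succ N ih =>
      rw [Finset.sum_range_succ, mul_add, ih]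
      push_cast
      ring
  rw [h]
  ring

/-- The `q`-th Fourier coefficient of the perturbation of the configuration. -/
noncomputable def waveCoeff (n : ℕ) (c : ℝ) (q : ℕ) : ℂ :=
  (n : ℂ)⁻¹ * ∑ k ∈ Finset.range n, (wave n c k : ℂ) * (starRingEnd ℂ) (zeta n ^ (k * q))

theorem norm_waveCoeff {n : ℕ} (hn : Even n) (hn0 : 0 < n) {c : ℝ} (hc : 0 ≤ c) {q : ℕ}
    (hq : q < n) :
    ‖waveCoeff n c q‖ =
      if Even q then 0 else 4 * c / (n ^ 3 * Real.sin (Real.pi * q / n) ^ 2) := by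
  obtain ⟨m, rfl⟩ := hn
  have hm : 0 < m := by omega
  have hm' : (0 : ℝ) < m := by exact_mod_cast hm
  have hζ := zeta_isPrimitiveRoot hn0.ne'
  set z : ℂ := (starRingEnd ℂ) (zeta (m + m) ^ q) with hz
  have hpow : ∀ k, (starRingEnd ℂ) (zeta (m + m) ^ (k * q)) = z ^ k := by
    intro k
    rw [hz, ← map_pow, ← pow_mul, mul_comm]
  have hzm : z ^ m = (-1) ^ q := by
    rw [← hpow, pow_mul, zeta_pow_half hm]
    simp
  have hanti := sum_antiperiodic (m := m) (fun k => (wave (m + m) c k : ℂ)) (by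
    intro k hk
    have := wave_right (m := m) c (k := k) (by positivity) (by exact_mod_cast hk.le)
    push_cast
    rw [this]
    push_cast
    rfl) z
  rw [waveCoeff]
  simp only [hpow]
  rw [hanti, hzm]
  split_ifs with h
  · simp [h.neg_one_pow]
  · have hodd : Odd q := Nat.not_even_iff_odd.1 h
    have hz1 : ‖1 - z‖ ^ 2 = 4 * Real.sin (Real.pi * q / (m + m : ℕ)) ^ 2 := by
      have := norm_sq_zeta_sub (m + m) q 0
      rw [← RCLike.norm_conj, map_sub, pow_zero, map_one, ← hz, norm_sub_rev] at this
      rw [this, Nat.cast_zero, sub_zero]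
    have hne : 1 - z ≠ 0 := by
      intro h0
      have h1 : z = 1 := (sub_eq_zero.1 h0).symm
      rw [h1, one_pow, hodd.neg_one_pow] at hzm
      norm_num at hzm
    have hsum : ∑ k ∈ Finset.range m, (wave (m + m) c k : ℂ) * z ^ k =
        -((c / m ^ 2 : ℝ) : ℂ) * (2 * z) / (1 - z) ^ 2 := by
      have h1 := sum_linear_mul_pow m z
      rw [hzm, hodd.neg_one_pow] at h1
      have h2 : ∑ k ∈ Finset.range m, (wave (m + m) c k : ℂ) * z ^ k =
          ((c / (2 * m ^ 2) : ℝ) : ℂ) * ∑ k ∈ Finset.range m, ((m : ℂ) - 2 * k) * z ^ k := by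
        rw [Finset.mul_sum]
        refine Finset.sum_congr rfl fun k hk => ?_
        rw [wave_left hm c (by exact_mod_cast (Finset.mem_range.1 hk).le), ← mul_assoc]
        congr 1
        have hmc : (m : ℂ) ≠ 0 := by exact_mod_cast hm.ne'
        push_cast
        field_simp
        ring
      rw [h2, eq_div_iff (pow_ne_zero 2 hne)]
      calc _ = ((c / (2 * m ^ 2) : ℝ) : ℂ) *
            ((1 - z) ^ 2 * ∑ k ∈ Finset.range m, ((m : ℂ) - 2 * k) * z ^ k) := by ring
        _ = _ := by rw [h1]; push_cast; ring
    have hz1' : ‖z‖ = 1 := by rw [hz, RCLike.norm_conj, norm_zeta_pow]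
    have hc2 : 0 ≤ c / (m : ℝ) ^ 2 := by positivity
    rw [hsum, hodd.neg_one_pow]
    rw [norm_mul, norm_mul, norm_div, norm_mul, norm_neg, norm_mul, norm_pow, hz1, hz1', norm_inv,
      Complex.norm_natCast, Complex.norm_real, Real.norm_of_nonneg hc2]
    norm_num
    have hs : Real.sin (Real.pi * q / (m + m)) ^ 2 ≠ 0 := by
      intro h0
      push_cast at hz1
      rw [h0, mul_zero] at hz1
      exact hne (norm_eq_zero.1 (pow_eq_zero_iff two_ne_zero |>.1 hz1))
    have hs' : Real.sin (Real.pi * q / (m + m)) ≠ 0 := fun h0 => hs (by rw [h0]; simp)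
    field_simp
    ring

/-- The quadratic form with kernel `1 / sin²`, evaluated at the perturbation. -/
theorem sum_wave_quadratic_form {n : ℕ} (hn : Even n) (hn0 : 0 < n) {c : ℝ} (hc : 0 ≤ c) :
    ∑ i ∈ Finset.range n, ∑ j ∈ Finset.range n,
      (if i = j then 0 else (wave n c i - wave n c j) ^ 2 /
        Real.sin (Real.pi * ((i : ℝ) - j) / n) ^ 2) =
      64 * c ^ 2 / (n : ℝ) ^ 5 * ∑ q ∈ Finset.range n, if Even q then 0 else
        (q : ℝ) * (n - q) / Real.sin (Real.pi * q / n) ^ 4 := by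
  have h := sum_norm_sq_quotient n (fun j => (wave n c j : ℂ)) (waveCoeff n c)
    fun j hj => (dft_inversion (fun k => (wave n c k : ℂ)) hj).symm
  have hn' : (n : ℝ) ≠ 0 := by exact_mod_cast hn0.ne'
  calc _ = 4 * ∑ i ∈ Finset.range n, ∑ j ∈ Finset.range n,
      (if i = j then 0 else ‖(wave n c i : ℂ) - wave n c j‖ ^ 2 /
        ‖zeta n ^ i - zeta n ^ j‖ ^ 2) := by
        simp only [Finset.mul_sum]
        refine Finset.sum_congr rfl fun i _ => Finset.sum_congr rfl fun j _ => ?_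
        split_ifs
        · simp
        · rw [norm_sq_zeta_sub, ← Complex.ofReal_sub, Complex.norm_real, Real.norm_eq_abs, sq_abs,
            mul_div_assoc', mul_div_mul_left _ _ (by norm_num : (4 : ℝ) ≠ 0)]
    _ = _ := by
        rw [h]
        simp only [Finset.mul_sum]
        refine Finset.sum_congr rfl fun q hq => ?_
        rw [norm_waveCoeff hn hn0 hc (Finset.mem_range.1 hq)]
        split_ifs
        · simp
        · rw [div_pow, mul_pow, mul_pow]
          generalize Real.sin _ = s
          by_cases hs : s = 0
          · simp [hs]
          · field_simp
            ring

/-! ### The sum of the inverse cubes of the odd numbers -/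

/-- `∑ 1/q³` over odd `q`, that is `7ζ(3)/8`. -/
noncomputable def oddCubeSum : ℝ := ∑' k : ℕ, 1 / (2 * (k : ℝ) + 1) ^ 3

theorem summable_oddCube : Summable fun k : ℕ => 1 / (2 * (k : ℝ) + 1) ^ 3 := by
  have h := (Real.summable_one_div_nat_pow.2 (by norm_num : 1 < 3)).comp_injective
    (show Function.Injective fun k : ℕ => 2 * k + 1 from fun a b h => by
      simpa using h)
  refine h.congr fun k => ?_
  simp

theorem tail_le_of_telescoping {f g : ℕ → ℝ} (hf : Summable f) {N : ℕ} (hg : ∀ k, 0 ≤ g k)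
    (h : ∀ k, N ≤ k → f k ≤ g k - g (k + 1)) :
    ∑' k, f k - ∑ k ∈ Finset.range N, f k ≤ g N := by
  have h1 : ∀ M, ∑ k ∈ Finset.range (N + M), f k ≤ ∑ k ∈ Finset.range N, f k + g N - g (N + M) := by
    intro M
    induction M with
    | zero => simp
    | succ M ih =>
      rw [← add_assoc, Finset.sum_range_succ]
      have := h (N + M) (by omega)
      linarith
  have h2 : Tendsto (fun M => ∑ k ∈ Finset.range (N + M), f k) atTop (𝓝 (∑' k, f k)) := by
    have := (tendsto_add_atTop_iff_nat (f := fun M => ∑ k ∈ Finset.range M, f k) N).2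
      hf.hasSum.tendsto_sum_nat
    simpa [add_comm] using this
  have := le_of_tendsto' h2 (b := ∑ k ∈ Finset.range N, f k + g N) fun M => by
    linarith [h1 M, hg (N + M)]
  linarith

theorem le_tail_of_telescoping {f g : ℕ → ℝ} (hf : Summable f) {N : ℕ}
    (hg : Tendsto g atTop (𝓝 0)) (h : ∀ k, N ≤ k → g k - g (k + 1) ≤ f k) :
    g N ≤ ∑' k, f k - ∑ k ∈ Finset.range N, f k := by
  have h1 : ∀ M, ∑ k ∈ Finset.range N, f k + g N - g (N + M) ≤ ∑ k ∈ Finset.range (N + M), f k := by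
    intro M
    induction M with
    | zero => simp
    | succ M ih =>
      rw [← add_assoc, Finset.sum_range_succ]
      have := h (N + M) (by omega)
      linarith
  have h2 : Tendsto (fun M => ∑ k ∈ Finset.range (N + M), f k) atTop (𝓝 (∑' k, f k)) := by
    have := (tendsto_add_atTop_iff_nat (f := fun M => ∑ k ∈ Finset.range M, f k) N).2
      hf.hasSum.tendsto_sum_nat
    simpa [add_comm] using this
  have h3 : Tendsto (fun M => ∑ k ∈ Finset.range N, f k + g N - g (N + M)) atTop
      (𝓝 (∑ k ∈ Finset.range N, f k + g N - 0)) := by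
    refine tendsto_const_nhds.sub ?_
    have := (tendsto_add_atTop_iff_nat (f := g) N).2 hg
    simpa [add_comm] using this
  have := le_of_tendsto_of_tendsto' h3 h2 h1
  linarith

/-- The telescoping majorant of `1/q³` with `g(q - 1) - g(q + 1)`, `g(x) = 1/(4(x² + α))`. It would
be a minorant for `α = 1`, so `α` slightly below `1` is sharp. -/
theorem oddCubeSum_tail_le {N : ℕ} {α : ℝ} (hα : 0 < α)
    (h : (1 + α) ^ 2 ≤ (2 - 2 * α) * (2 * (N : ℝ) + 1) ^ 2) :
    oddCubeSum - ∑ k ∈ Finset.range N, 1 / (2 * (k : ℝ) + 1) ^ 3 ≤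
      1 / (4 * ((2 * (N : ℝ)) ^ 2 + α)) := by
  refine tail_le_of_telescoping (g := fun k : ℕ => 1 / (4 * ((2 * (k : ℝ)) ^ 2 + α)))
    summable_oddCube (fun k => by positivity) fun k hk => ?_
  have hkN : (N : ℝ) ≤ k := by exact_mod_cast hk
  have h0 : 0 < 2 - 2 * α := by
    by_contra hneg
    have : 0 < (1 + α) ^ 2 := by positivity
    have h3 : (2 - 2 * α) * (2 * (N : ℝ) + 1) ^ 2 ≤ 0 :=
      mul_nonpos_of_nonpos_of_nonneg (not_lt.1 hneg) (by positivity)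
    linarith
  have h1 : (1 + α) ^ 2 ≤ (2 - 2 * α) * (2 * (k : ℝ) + 1) ^ 2 := h.trans (by gcongr)
  push_cast
  rw [div_sub_div _ _ (by positivity) (by positivity), div_le_div_iff₀ (by positivity) (by positivity)]
  have e : (1 * (4 * ((2 * ((k : ℝ) + 1)) ^ 2 + α)) - 4 * ((2 * (k : ℝ)) ^ 2 + α) * 1) *
      (2 * (k : ℝ) + 1) ^ 3 - 1 * (4 * ((2 * (k : ℝ)) ^ 2 + α) * (4 * ((2 * ((k : ℝ) + 1)) ^ 2 + α)))
      = 16 * ((2 - 2 * α) * (2 * (k : ℝ) + 1) ^ 2 - (1 + α) ^ 2) := by ring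
  linarith

theorem le_oddCubeSum_tail (N : ℕ) :
    1 / (4 * ((2 * (N : ℝ)) ^ 2 + 1)) ≤
      oddCubeSum - ∑ k ∈ Finset.range N, 1 / (2 * (k : ℝ) + 1) ^ 3 := by
  refine le_tail_of_telescoping (g := fun k : ℕ => 1 / (4 * ((2 * (k : ℝ)) ^ 2 + 1)))
    summable_oddCube ?_ fun k hk => ?_
  · refine squeeze_zero (fun k => by positivity) (fun k => ?_)
      (tendsto_one_div_add_atTop_nhds_zero_nat (𝕜 := ℝ))
    apply one_div_le_one_div_of_le (by positivity)
    nlinarith [sq_nonneg ((k : ℝ) - 1), (Nat.cast_nonneg k : (0 : ℝ) ≤ k)]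
  · push_cast
    rw [div_sub_div _ _ (by positivity) (by positivity),
      div_le_div_iff₀ (by positivity) (by positivity)]
    have e : (1 * (4 * ((2 * ((k : ℝ) + 1)) ^ 2 + 1)) - 4 * ((2 * (k : ℝ)) ^ 2 + 1) * 1) *
      (2 * (k : ℝ) + 1) ^ 3 - 1 * (4 * ((2 * (k : ℝ)) ^ 2 + 1) * (4 * ((2 * ((k : ℝ) + 1)) ^ 2 + 1)))
      = -64 := by ring
    linarith

theorem oddCubeSum_bounds : 1.05179977 ≤ oddCubeSum ∧ oddCubeSum ≤ 1.05179981 := by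
  have h1 := le_oddCubeSum_tail 10
  -- `α = 199/200` is close to the largest value that the tail bound allows at `N = 10`.
  have h2 := oddCubeSum_tail_le (N := 10) (α := 199 / 200) (by norm_num) (by norm_num)
  norm_num [Finset.sum_range_succ] at h1 h2
  constructor <;> linarith

/-! ### Asymptotics of the spectral sum -/

theorem inv_sin_pow_four_bounds {x : ℝ} (hx : 0 < x) (hx' : x ≤ Real.pi / 2) :
    1 / x ^ 4 ≤ 1 / Real.sin x ^ 4 ∧ 1 / Real.sin x ^ 4 ≤ 1 / x ^ 4 + 5 / x ^ 2 := by
  have hs : 0 < Real.sin x := Real.sin_pos_of_pos_of_lt_pi hx (by linarith [Real.pi_pos])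
  have hle : Real.sin x ≤ x := Real.sin_le hx.le
  have htan := mul_cos_le_sin hx.le hx'
  have hc0 : 0 ≤ Real.cos x := Real.cos_nonneg_of_mem_Icc ⟨by linarith [Real.pi_pos], hx'⟩
  refine ⟨by gcongr, ?_⟩
  have h1 : (x * Real.cos x) ^ 2 ≤ Real.sin x ^ 2 := by gcongr
  rw [mul_pow, Real.cos_sq'] at h1
  have h2 : 1 / Real.sin x ^ 2 ≤ 1 / x ^ 2 + 1 := by
    rw [div_add_one (by positivity), div_le_div_iff₀ (by positivity) (by positivity)]
    linarith
  have hx2 : x ^ 2 ≤ 3 := by nlinarith [pi_sq_lt, Real.pi_pos]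
  have h3 : 1 ≤ 3 / x ^ 2 := by rw [le_div_iff₀ (by positivity)]; linarith
  calc 1 / Real.sin x ^ 4 = (1 / Real.sin x ^ 2) ^ 2 := by ring
    _ ≤ (1 / x ^ 2 + 1) ^ 2 := by gcongr
    _ = 1 / x ^ 4 + 2 / x ^ 2 + 1 := by ring
    _ ≤ 1 / x ^ 4 + 2 / x ^ 2 + 3 / x ^ 2 := by gcongr
    _ = _ := by ring

theorem spectral_term_approx_left {n q : ℝ} (hq : 0 < q) (hqn : 2 * q ≤ n) :
    |q * (n - q) / Real.sin (Real.pi * q / n) ^ 4 -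
      n ^ 5 / Real.pi ^ 4 * (1 / q ^ 3 + 1 / (n - q) ^ 3)| ≤ 2 * n ^ 4 * (1 / q ^ 2) := by
  have hn : 0 < n := by linarith
  have hpi := Real.pi_pos
  have hx : 0 < Real.pi * q / n := by positivity
  have hx' : Real.pi * q / n ≤ Real.pi / 2 := by
    rw [div_le_div_iff₀ hn (by norm_num)]
    nlinarith
  obtain ⟨h1, h2⟩ := inv_sin_pow_four_bounds hx hx'
  have hs : 2 * q / n ≤ Real.sin (Real.pi * q / n) := by
    have := Real.mul_le_sin hx.le hx'
    calc 2 * q / n = 2 / Real.pi * (Real.pi * q / n) := by field_simp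
      _ ≤ _ := this
  have hs0 : 0 < 2 * q / n := by positivity
  set S := Real.sin (Real.pi * q / n)
  have hS : 0 < S := hs0.trans_le hs
  have ha : 0 ≤ q * n * (1 / S ^ 4 - 1 / (Real.pi * q / n) ^ 4) := by
    apply mul_nonneg (by positivity); linarith
  have hb : q * n * (1 / S ^ 4 - 1 / (Real.pi * q / n) ^ 4) ≤ n ^ 4 * (1 / q ^ 2) := by
    calc _ ≤ q * n * (5 / (Real.pi * q / n) ^ 2) := by gcongr; linarith
      _ = (5 / Real.pi ^ 2 * (q / n)) * (n ^ 4 * (1 / q ^ 2)) := by field_simp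
      _ ≤ 1 * (n ^ 4 * (1 / q ^ 2)) := by
        gcongr
        have e1 : 5 / Real.pi ^ 2 ≤ 1 := by
          rw [div_le_one (by positivity)]; linarith [lt_pi_sq]
        have e2 : q / n ≤ 1 := by rw [div_le_one hn]; linarith
        exact mul_le_one₀ e1 (by positivity) e2
      _ = _ := one_mul _
  have hc : q ^ 2 / S ^ 4 ≤ 1 / 16 * (n ^ 4 * (1 / q ^ 2)) := by
    calc q ^ 2 / S ^ 4 ≤ q ^ 2 / (2 * q / n) ^ 4 := by gcongr
      _ = _ := by field_simp; norm_num
  have hc0 : 0 ≤ q ^ 2 / S ^ 4 := by positivity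
  have hd : n ^ 5 / Real.pi ^ 4 * (1 / (n - q) ^ 3) ≤ 2 / 81 * (n ^ 4 * (1 / q ^ 2)) := by
    have e1 : q ^ 2 * (n / 2) ≤ (n - q) ^ 3 := by
      calc q ^ 2 * (n / 2) ≤ (n - q) ^ 2 * (n - q) := by
            gcongr <;> linarith
        _ = _ := by ring
    have e2 : 81 ≤ Real.pi ^ 4 := by nlinarith [lt_pi_sq]
    have e3 : 0 ≤ 1 / (n - q) ^ 3 := by
      have : 0 < n - q := by linarith
      positivity
    calc n ^ 5 / Real.pi ^ 4 * (1 / (n - q) ^ 3) ≤ n ^ 5 / 81 * (1 / (q ^ 2 * (n / 2))) := by gcongr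
      _ = _ := by field_simp
  have hd0 : 0 ≤ n ^ 5 / Real.pi ^ 4 * (1 / (n - q) ^ 3) := by
    have : 0 < n - q := by linarith
    positivity
  have e : q * (n - q) / S ^ 4 - n ^ 5 / Real.pi ^ 4 * (1 / q ^ 3 + 1 / (n - q) ^ 3) =
      q * n * (1 / S ^ 4 - 1 / (Real.pi * q / n) ^ 4) - q ^ 2 / S ^ 4 -
        n ^ 5 / Real.pi ^ 4 * (1 / (n - q) ^ 3) := by
    have : q * n * (1 / (Real.pi * q / n) ^ 4) = n ^ 5 / Real.pi ^ 4 * (1 / q ^ 3) := by field_simp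
    linear_combination this
  have hpos : 0 ≤ n ^ 4 * (1 / q ^ 2) := by positivity
  rw [e, abs_le]
  constructor <;> linarith

/-- Both ends of the range `0 < q < n` contribute to the spectral sum in the same way. -/
theorem spectral_term_approx {n q : ℝ} (hq : 0 < q) (hqn : q < n) :
    |q * (n - q) / Real.sin (Real.pi * q / n) ^ 4 -
      n ^ 5 / Real.pi ^ 4 * (1 / q ^ 3 + 1 / (n - q) ^ 3)| ≤
      2 * n ^ 4 * (1 / q ^ 2 + 1 / (n - q) ^ 2) := by
  have hn : 0 < n := by linarith
  have hnq : 0 < n - q := by linarith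
  rcases le_total (2 * q) n with h | h
  · refine (spectral_term_approx_left hq h).trans ?_
    gcongr
    have : 0 ≤ 1 / (n - q) ^ 2 := by positivity
    linarith
  · have h1 := spectral_term_approx_left hnq (by linarith : 2 * (n - q) ≤ n)
    rw [show Real.pi * (n - q) / n = Real.pi - Real.pi * q / n by field_simp, Real.sin_pi_sub,
      sub_sub_cancel, mul_comm (n - q) q, add_comm (1 / (n - q) ^ 3)] at h1
    refine h1.trans ?_
    gcongr
    have : 0 ≤ 1 / q ^ 2 := by positivity
    linarith

theorem sum_odd_reflect {n : ℕ} (hn : Even n) (f : ℝ → ℝ) :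
    ∑ q ∈ (Finset.range n).filter (fun q => ¬Even q), f ((n : ℝ) - q) =
      ∑ q ∈ (Finset.range n).filter (fun q => ¬Even q), f q := by
  refine Finset.sum_nbij' (fun q => n - q) (fun q => n - q) ?_ ?_ ?_ ?_ ?_ <;> intro q hq <;>
    simp only [Finset.mem_filter, Finset.mem_range] at hq ⊢
  · have : q ≠ 0 := fun h => hq.2 (h ▸ Even.zero)
    rw [Nat.even_sub hq.1.le]
    exact ⟨by omega, by tauto⟩
  · have : q ≠ 0 := fun h => hq.2 (h ▸ Even.zero)
    rw [Nat.even_sub hq.1.le]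
    exact ⟨by omega, by tauto⟩
  · omega
  · omega
  · rw [Nat.cast_sub hq.1.le]

theorem sum_odd_eq (m : ℕ) (f : ℝ → ℝ) :
    ∑ q ∈ (Finset.range (m + m)).filter (fun q => ¬Even q), f q =
      ∑ k ∈ Finset.range m, f (2 * k + 1) := by
  symm
  refine Finset.sum_nbij' (fun k => 2 * k + 1) (fun q => q / 2) ?_ ?_ ?_ ?_ ?_ <;> intro q hq <;>
    simp only [Finset.mem_filter, Finset.mem_range, Nat.not_even_iff_odd] at hq ⊢
  · exact ⟨by omega, odd_two_mul_add_one q⟩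
  · omega
  · omega
  · obtain ⟨-, k, rfl⟩ := hq
    omega
  · push_cast; rfl

theorem sum_odd_inv_sq_le (m : ℕ) :
    ∑ k ∈ Finset.range m, 1 / (2 * (k : ℝ) + 1) ^ 2 ≤ 2 := by
  rcases m with _ | m
  · simp
  have h : ∀ m : ℕ, ∑ k ∈ Finset.range (m + 1), 1 / (2 * (k : ℝ) + 1) ^ 2 ≤
      2 - 1 / (2 * (m : ℝ) + 1) := by
    intro m
    induction m with
    | zero => norm_num
    | succ m ih =>
      rw [Finset.sum_range_succ]
      have : 1 / (2 * ((m + 1 : ℕ) : ℝ) + 1) ^ 2 ≤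
          1 / (2 * (m : ℝ) + 1) - 1 / (2 * ((m + 1 : ℕ) : ℝ) + 1) := by
        push_cast
        rw [div_sub_div _ _ (by positivity) (by positivity),
          div_le_div_iff₀ (by positivity) (by positivity)]
        nlinarith [(Nat.cast_nonneg m : (0 : ℝ) ≤ m), pow_nonneg (Nat.cast_nonneg m : (0 : ℝ) ≤ m) 2]
      linarith
  have h0 : 0 ≤ 1 / (2 * (m : ℝ) + 1) := by positivity
  linarith [h m]

theorem spectral_sum_approx {n : ℕ} (hn : Even n) (hn0 : 0 < n) :
    |8 / (n : ℝ) ^ 5 * (∑ q ∈ Finset.range n, if Even q then 0 else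
        (q : ℝ) * (n - q) / Real.sin (Real.pi * q / n) ^ 4) - 16 * oddCubeSum / Real.pi ^ 4| ≤
      80 / (n : ℝ) := by
  obtain ⟨m, hm⟩ := hn
  have hn' : (0 : ℝ) < n := by exact_mod_cast hn0
  set S := (Finset.range n).filter (fun q => ¬Even q) with hS
  set T := ∑ q ∈ Finset.range n, if Even q then 0 else
        (q : ℝ) * (n - q) / Real.sin (Real.pi * q / n) ^ 4 with hT
  have hTS : T = ∑ q ∈ S, (q : ℝ) * (n - q) / Real.sin (Real.pi * q / n) ^ 4 := by
    rw [hT, hS, Finset.sum_filter]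
    refine Finset.sum_congr rfl fun q _ => ?_
    by_cases h : Even q <;> simp [h]
  set P := ∑ k ∈ Finset.range m, 1 / (2 * (k : ℝ) + 1) ^ 3 with hP
  have hcube : ∑ q ∈ S, (1 / (q : ℝ) ^ 3 + 1 / ((n : ℝ) - q) ^ 3) = 2 * P := by
    rw [Finset.sum_add_distrib, sum_odd_reflect ⟨m, hm⟩ (fun x => 1 / x ^ 3), hS, hm,
      sum_odd_eq m (fun x => 1 / x ^ 3)]
    ring
  have hsq : ∑ q ∈ S, (1 / (q : ℝ) ^ 2 + 1 / ((n : ℝ) - q) ^ 2) ≤ 4 := by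
    rw [Finset.sum_add_distrib, sum_odd_reflect ⟨m, hm⟩ (fun x => 1 / x ^ 2), hS, hm,
      sum_odd_eq m (fun x => 1 / x ^ 2)]
    linarith [sum_odd_inv_sq_le m]
  have h1 : |T - (n : ℝ) ^ 5 / Real.pi ^ 4 * (2 * P)| ≤ 8 * (n : ℝ) ^ 4 := by
    rw [hTS, ← hcube, Finset.mul_sum, ← Finset.sum_sub_distrib]
    refine (Finset.abs_sum_le_sum_abs _ _).trans ?_
    calc _ ≤ ∑ q ∈ S, 2 * (n : ℝ) ^ 4 * (1 / (q : ℝ) ^ 2 + 1 / ((n : ℝ) - q) ^ 2) := by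
          refine Finset.sum_le_sum fun q hq => spectral_term_approx ?_ ?_
          · have : q ≠ 0 := fun h => (Finset.mem_filter.1 hq).2 (h ▸ Even.zero)
            exact_mod_cast Nat.pos_of_ne_zero this
          · exact_mod_cast Finset.mem_range.1 (Finset.mem_filter.1 hq).1
      _ ≤ 2 * (n : ℝ) ^ 4 * 4 := by rw [← Finset.mul_sum]; gcongr
      _ = _ := by ring
  have hm1 : (1 : ℝ) ≤ m := by exact_mod_cast (by omega : 1 ≤ m)
  have hnm : (n : ℝ) = 2 * m := by rw [hm]; push_cast; ring
  have h2 : oddCubeSum - P ≤ 1 / n := by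
    refine (oddCubeSum_tail_le (N := m) (α := 1 / 2) (by norm_num) (by nlinarith)).trans ?_
    apply one_div_le_one_div_of_le hn'
    rw [hnm]; nlinarith
  have h2' : 0 ≤ oddCubeSum - P :=
    le_trans (by positivity) (le_oddCubeSum_tail m)
  have e : 8 / (n : ℝ) ^ 5 * T - 16 * oddCubeSum / Real.pi ^ 4 =
      8 / (n : ℝ) ^ 5 * (T - (n : ℝ) ^ 5 / Real.pi ^ 4 * (2 * P)) -
        16 / Real.pi ^ 4 * (oddCubeSum - P) := by
    have := Real.pi_pos
    field_simp
    ring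
  have h3 : |8 / (n : ℝ) ^ 5 * (T - (n : ℝ) ^ 5 / Real.pi ^ 4 * (2 * P))| ≤ 64 / (n : ℝ) := by
    rw [abs_mul, abs_of_pos (by positivity)]
    calc _ ≤ 8 / (n : ℝ) ^ 5 * (8 * (n : ℝ) ^ 4) := by gcongr
      _ = _ := by field_simp; norm_num
  have h4 : |16 / Real.pi ^ 4 * (oddCubeSum - P)| ≤ 16 / (n : ℝ) := by
    rw [abs_of_nonneg (mul_nonneg (by positivity) h2')]
    have e2 : 16 / Real.pi ^ 4 ≤ 16 := div_le_self (by norm_num) (by nlinarith [lt_pi_sq])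
    calc _ ≤ 16 * (1 / (n : ℝ)) := by gcongr
      _ = _ := by ring
  rw [e]
  calc _ ≤ 64 / (n : ℝ) + 16 / n := (abs_sub _ _).trans (add_le_add h3 h4)
    _ = _ := by ring

/-! ### The product of distances as a perturbation of the regular polygon -/

theorem prod_offDiag_eq (n : ℕ) (G : ℕ → ℕ → ℝ) :
    ∏ p ∈ (Finset.univ : Finset (Fin n)).offDiag, G (p.1 : ℕ) (p.2 : ℕ) =
      ∏ i ∈ Finset.range n, ∏ j ∈ Finset.range n, if i = j then 1 else G i j := by
  have h : (Finset.univ : Finset (Fin n)).offDiag =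
      ((Finset.univ : Finset (Fin n)) ×ˢ Finset.univ).filter (fun p => ¬p.1 = p.2) := by
    ext p; simp
  rw [h, Finset.prod_filter, Finset.prod_product, Finset.prod_range]
  refine Finset.prod_congr rfl fun i _ => ?_
  rw [Finset.prod_range]
  refine Finset.prod_congr rfl fun j _ => ?_
  by_cases hij : i = j
  · simp [hij]
  · have : (i : ℕ) ≠ j := fun h => hij (Fin.ext h)
    simp [hij, this]

/-- The derivative of `X^n - 1` at a root, as a product over the other roots. -/
theorem prod_norm_zeta_sub {n i : ℕ} (hi : i < n) :
    ∏ j ∈ Finset.range n, (if i = j then 1 else ‖zeta n ^ i - zeta n ^ j‖) = n := by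
  have hn0 : n ≠ 0 := by omega
  have hζ := zeta_isPrimitiveRoot hn0
  have hi' : i ∈ Finset.range n := Finset.mem_range.2 hi
  have hprod := X_pow_sub_C_eq_prod hζ (by omega) (one_pow n)
  rw [← Finset.mul_prod_erase _ _ hi'] at hprod
  have hgeom := (Commute.all Polynomial.X (Polynomial.C (zeta n ^ i))).mul_geom_sum₂ n
  rw [← Polynomial.C_pow, ← pow_mul, mul_comm i n, pow_mul, hζ.pow_eq_one, one_pow, hprod,
    mul_one] at hgeom
  have h := mul_left_cancel₀ (Polynomial.X_sub_C_ne_zero (zeta n ^ i)) hgeom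
  apply_fun fun p => ‖Polynomial.eval (zeta n ^ i) p‖ at h
  simp only [Polynomial.eval_finsetSum, Polynomial.eval_mul, Polynomial.eval_pow,
    Polynomial.eval_X, Polynomial.eval_C, Polynomial.eval_prod, Polynomial.eval_sub, mul_one] at h
  have hs : ∀ k ∈ Finset.range n, (zeta n ^ i) ^ k * (zeta n ^ i) ^ (n - 1 - k) =
      (zeta n ^ i) ^ (n - 1) := by
    intro k hk
    rw [← pow_add]
    congr 1
    have := Finset.mem_range.1 hk
    omega
  rw [Finset.sum_congr rfl hs, Finset.sum_const, Finset.card_range, nsmul_eq_mul, norm_mul,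
    norm_pow, norm_zeta_pow, one_pow, mul_one, Complex.norm_natCast, norm_prod] at h
  rw [h, ← Finset.mul_prod_erase _ _ hi', if_pos rfl, one_mul]
  refine Finset.prod_congr rfl fun j hj => ?_
  rw [if_neg (Finset.ne_of_mem_erase hj).symm]

/-- The relative perturbation of `z_i - z_j`: its modulus satisfies
`|z_i - z_j| = |ω^i - ω^j| |1 + w_ij|`. -/
noncomputable def relPert (n : ℕ) (c : ℝ) (i j : ℕ) : ℂ :=
  ⟨(wave n c i + wave n c j) / 2,
    (wave n c i - wave n c j) * Real.cos (Real.pi * ((i : ℝ) - j) / n) /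
      Real.sin (Real.pi * ((i : ℝ) - j) / n) / 2⟩

theorem sin_ne_zero_of_ne {n i j : ℕ} (hi : i < n) (hj : j < n) (hij : i ≠ j) :
    Real.sin (Real.pi * ((i : ℝ) - j) / n) ≠ 0 := by
  intro h
  have h1 := norm_sq_zeta_sub n i j
  rw [h] at h1
  have h2 : zeta n ^ i - zeta n ^ j = 0 := by
    rw [← norm_eq_zero]
    simpa using h1
  exact hij ((zeta_isPrimitiveRoot (by omega)).pow_inj hi hj (sub_eq_zero.1 h2))

theorem norm_config_sub {n : ℕ} (hn : Even n) (c : ℝ) (i j : Fin n) (hij : i ≠ j) :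
    ‖config n c i - config n c j‖ =
      ‖zeta n ^ (i : ℕ) - zeta n ^ (j : ℕ)‖ * ‖1 + relPert n c i j‖ := by
  have hs := sin_ne_zero_of_ne i.2 j.2 fun h => hij (Fin.ext h)
  refine (sq_eq_sq₀ (norm_nonneg _) (by positivity)).1 ?_
  rw [← dist_eq_norm, dist_sq_config hn, mul_pow, norm_sq_zeta_sub,
    ← Complex.normSq_eq_norm_sq (1 + _), Complex.normSq_apply]
  simp only [relPert, Complex.add_re, Complex.add_im, Complex.one_re, Complex.one_im]
  field_simp
  ring

theorem abs_wave_sub_le_sin {n : ℕ} {c : ℝ} (hc : 0 ≤ c) {i j : ℕ} (hi : i < n) (hj : j < n) :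
    |wave n c i - wave n c j| ≤ 2 * c / n * |Real.sin (Real.pi * ((i : ℝ) - j) / n)| := by
  have hn : (0 : ℝ) < n := by exact_mod_cast (by omega : 0 < n)
  have hpi := Real.pi_pos
  have hi' : (i : ℝ) ≤ n := by exact_mod_cast hi.le
  have hj' : (j : ℝ) ≤ n := by exact_mod_cast hj.le
  have hi0 : (0 : ℝ) ≤ i := by positivity
  have hj0 : (0 : ℝ) ≤ j := by positivity
  set d := |(i : ℝ) - j| with hd
  have hd0 : 0 ≤ d := abs_nonneg _
  have hdn : d ≤ n := by rw [hd, abs_le]; constructor <;> linarith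
  have hsin : |Real.sin (Real.pi * ((i : ℝ) - j) / n)| = |Real.sin (Real.pi * d / n)| := by
    rcases abs_choice ((i : ℝ) - j) with h | h
    · rw [hd, h]
    · rw [hd, h, mul_neg, neg_div, Real.sin_neg, abs_neg]
  -- Jordan's inequality `sin (π x / n) ≥ 2 x / n` for `0 ≤ x ≤ n / 2`
  have hjordan : ∀ x : ℝ, 0 ≤ x → x ≤ n / 2 → 2 * x / n ≤ Real.sin (Real.pi * x / n) := by
    intro x hx hx'
    have := Real.mul_le_sin (x := Real.pi * x / n) (by positivity) (by
      rw [div_le_div_iff₀ hn (by norm_num)]; nlinarith)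
    calc 2 * x / n = 2 / Real.pi * (Real.pi * x / n) := by field_simp
      _ ≤ _ := this
  rw [hsin]
  rcases le_total d (n / 2) with h | h
  · calc _ ≤ 4 * c / (n : ℝ) ^ 2 * d := abs_wave_sub_le hc
      _ = 2 * c / n * (2 * d / n) := by field_simp; ring
      _ ≤ _ := by
        gcongr
        exact (hjordan d hd0 h).trans (le_abs_self _)
  · calc _ ≤ 4 * c / (n : ℝ) ^ 2 * (n - d) := abs_wave_sub_le' hc hi0 hi' hj0 hj'
      _ = 2 * c / n * (2 * (n - d) / n) := by field_simp; ring
      _ ≤ _ := by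
        gcongr
        have := hjordan (n - d) (by linarith) (by linarith)
        rw [show Real.pi * (n - d) / n = Real.pi - Real.pi * d / n by field_simp,
          Real.sin_pi_sub] at this
        exact this.trans (le_abs_self _)

theorem norm_relPert_le {n : ℕ} {c : ℝ} (hc : 0 ≤ c) {i j : ℕ} (hi : i < n) (hj : j < n)
    (hij : i ≠ j) : ‖relPert n c i j‖ ≤ 2 * c / n := by
  have hs := sin_ne_zero_of_ne hi hj hij
  have hs' : 0 < |Real.sin (Real.pi * ((i : ℝ) - j) / n)| := abs_pos.2 hs
  have h1 : |(relPert n c i j).re| ≤ c / n := by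
    have h1 := abs_wave_le hc (Nat.cast_nonneg i) (Nat.cast_le.2 hi.le)
    have h2 := abs_wave_le hc (Nat.cast_nonneg j) (Nat.cast_le.2 hj.le)
    simp only [relPert]
    rw [abs_div, abs_two, div_le_iff₀ two_pos]
    linarith [abs_add_le (wave n c i) (wave n c j)]
  have h2 : |(relPert n c i j).im| ≤ c / n := by
    simp only [relPert]
    rw [abs_div, abs_two, div_le_iff₀ two_pos, abs_div, abs_mul, div_le_iff₀ hs']
    calc _ ≤ 2 * c / n * |Real.sin (Real.pi * ((i : ℝ) - j) / n)| * 1 := by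
          gcongr
          · exact abs_wave_sub_le_sin hc hi hj
          · exact Real.abs_cos_le_one _
      _ = _ := by ring
  calc _ ≤ |(relPert n c i j).re| + |(relPert n c i j).im| := Complex.norm_le_abs_re_add_abs_im _
    _ ≤ c / n + c / n := add_le_add h1 h2
    _ = _ := by ring

theorem abs_log_norm_one_add_sub_le {w : ℂ} (hw : ‖w‖ ≤ 1 / 2) :
    |Real.log ‖1 + w‖ - (w.re - (w.re ^ 2 - w.im ^ 2) / 2)| ≤ ‖w‖ ^ 3 := by
  have h := Complex.norm_log_sub_logTaylor_le 2 (z := w) (by linarith)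
  have h2 : (Complex.log (1 + w) - Complex.logTaylor 3 w).re =
      Real.log ‖1 + w‖ - (w.re - (w.re ^ 2 - w.im ^ 2) / 2) := by
    rw [Complex.sub_re, Complex.log_re]
    congr 1
    have e : Complex.logTaylor 3 w = w - w * w / 2 := by
      simp [Complex.logTaylor_succ, Complex.logTaylor_zero, pow_two]
      ring
    rw [e]
    simp
    ring
  rw [← h2]
  refine (Complex.abs_re_le_norm _).trans (h.trans ?_)
  have h3 : (1 - ‖w‖)⁻¹ ≤ 2 := by
    rw [inv_le_comm₀ (by linarith) two_pos]; linarith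
  have h4 : 0 ≤ ‖w‖ ^ 3 := by positivity
  calc ‖w‖ ^ (2 + 1) * (1 - ‖w‖)⁻¹ / ((2 : ℕ) + 1) ≤ ‖w‖ ^ 3 * 2 / ((2 : ℕ) + 1) := by gcongr
    _ ≤ ‖w‖ ^ 3 := by push_cast; linarith

theorem norm_one_add_relPert_pos {n : ℕ} {c : ℝ} {i j : ℕ} (h : ‖relPert n c i j‖ ≤ 1 / 2) :
    0 < ‖1 + relPert n c i j‖ := by
  have := norm_sub_norm_le (1 : ℂ) (-relPert n c i j)
  rw [sub_neg_eq_add, norm_one, norm_neg] at this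
  linarith

theorem Delta_config_eq {n : ℕ} (hn : Even n) (c : ℝ) :
    Delta (config n c) = (n : ℝ) ^ n *
      ∏ i ∈ Finset.range n, ∏ j ∈ Finset.range n, (if i = j then 1 else ‖1 + relPert n c i j‖) := by
  have h1 : Delta (config n c) = ∏ p ∈ (Finset.univ : Finset (Fin n)).offDiag,
      (fun i j : ℕ => ‖zeta n ^ i - zeta n ^ j‖ * ‖1 + relPert n c i j‖) (p.1 : ℕ) (p.2 : ℕ) := by
    refine Finset.prod_congr rfl fun p hp => ?_
    exact norm_config_sub hn c _ _ (Finset.mem_offDiag.1 hp).2.2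
  rw [h1, prod_offDiag_eq n fun i j => ‖zeta n ^ i - zeta n ^ j‖ * ‖1 + relPert n c i j‖]
  have h2 : ∀ i j : ℕ,
      (if i = j then (1 : ℝ) else ‖zeta n ^ i - zeta n ^ j‖ * ‖1 + relPert n c i j‖) =
      (if i = j then 1 else ‖zeta n ^ i - zeta n ^ j‖) *
        (if i = j then 1 else ‖1 + relPert n c i j‖) := by
    intro i j
    split_ifs <;> simp
  simp only [h2, Finset.prod_mul_distrib]
  congr 1
  rw [Finset.prod_congr rfl fun i hi => prod_norm_zeta_sub (Finset.mem_range.1 hi)]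
  simp

/-! ### Expansion of the logarithm to second order -/

theorem sum_wave {m : ℕ} (c : ℝ) : ∑ k ∈ Finset.range (m + m), wave (m + m) c k = 0 := by
  rw [Finset.sum_range_add, ← Finset.sum_add_distrib]
  refine Finset.sum_eq_zero fun k hk => ?_
  have := wave_right (m := m) c (k := k) (by positivity)
    (by exact_mod_cast (Finset.mem_range.1 hk).le)
  rw [Nat.cast_add m k, add_comm (m : ℝ), this]
  ring

theorem sum_wave_sq {m : ℕ} (hm : 0 < m) (c : ℝ) :
    ∑ k ∈ Finset.range (m + m), wave (m + m) c k ^ 2 =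
      c ^ 2 * (1 / (6 * m) + 1 / (3 * (m : ℝ) ^ 3)) := by
  have hm' : (m : ℝ) ≠ 0 := by positivity
  have h : ∀ N : ℕ, ∑ k ∈ Finset.range N, ((m : ℝ) - 2 * k) ^ 2 =
      N * (m : ℝ) ^ 2 - 2 * m * (N * (N - 1)) + 2 / 3 * ((N - 1) * N * (2 * N - 1)) := by
    intro N
    induction N with
    | zero => simp
    | succ N ih => rw [Finset.sum_range_succ, ih]; push_cast; ring
  have h2 : ∀ k ∈ Finset.range m,
      wave (m + m) c k ^ 2 + wave (m + m) c ((m + k : ℕ) : ℝ) ^ 2 =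
        c ^ 2 / (2 * (m : ℝ) ^ 4) * ((m : ℝ) - 2 * k) ^ 2 := by
    intro k hk
    have hk' : (k : ℝ) ≤ m := by exact_mod_cast (Finset.mem_range.1 hk).le
    rw [Nat.cast_add m k, add_comm (m : ℝ), wave_right c (by positivity) hk', wave_left hm c hk']
    push_cast
    field_simp
    ring
  rw [Finset.sum_range_add, ← Finset.sum_add_distrib, Finset.sum_congr rfl h2, ← Finset.mul_sum, h]
  field_simp
  ring

theorem sum_offDiag_add {n : ℕ} (f : ℕ → ℝ) :
    ∑ i ∈ Finset.range n, ∑ j ∈ Finset.range n, (if i = j then 0 else f i + f j) =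
      2 * ((n : ℝ) - 1) * ∑ i ∈ Finset.range n, f i := by
  have h : ∀ i j : ℕ, (if i = j then 0 else f i + f j) = f i + f j - if i = j then 2 * f i else 0 := by
    intro i j
    split_ifs with h
    · rw [h]; ring
    · ring
  have h2 : ∀ i ∈ Finset.range n, ∑ j ∈ Finset.range n, (if i = j then 0 else f i + f j) =
      n * f i + ∑ j ∈ Finset.range n, f j - 2 * f i := by
    intro i hi
    simp only [h]
    rw [Finset.sum_sub_distrib, Finset.sum_add_distrib, Finset.sum_const, Finset.card_range,
      nsmul_eq_mul, Finset.sum_ite_eq, if_pos hi]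
  rw [Finset.sum_congr rfl h2, Finset.sum_sub_distrib, Finset.sum_add_distrib, Finset.sum_const,
    Finset.card_range, nsmul_eq_mul, ← Finset.mul_sum, ← Finset.mul_sum]
  ring

/-- The first-order terms cancel; the second-order terms are a spectral sum minus `∑ δ²`. -/
theorem sum_second_order {n : ℕ} (hn : Even n) (hn0 : 0 < n) {c : ℝ} (hc : 0 ≤ c) :
    ∑ i ∈ Finset.range n, ∑ j ∈ Finset.range n, (if i = j then 0 else
      (relPert n c i j).re - ((relPert n c i j).re ^ 2 - (relPert n c i j).im ^ 2) / 2) =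
    c ^ 2 * (8 / (n : ℝ) ^ 5 * (∑ q ∈ Finset.range n, if Even q then 0 else
        (q : ℝ) * (n - q) / Real.sin (Real.pi * q / n) ^ 4)
      - 1 / 6 * (1 - 1 / n) * (1 + 8 / (n : ℝ) ^ 2)) := by
  have hquad := sum_wave_quadratic_form hn hn0 hc
  have hn' : (n : ℝ) ≠ 0 := by exact_mod_cast hn0.ne'
  have hterm : ∀ i ∈ Finset.range n, ∀ j ∈ Finset.range n, (if i = j then 0 else
      (relPert n c i j).re - ((relPert n c i j).re ^ 2 - (relPert n c i j).im ^ 2) / 2) =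
      1 / 2 * (if i = j then 0 else wave n c i + wave n c j) +
      1 / 8 * (if i = j then 0 else (wave n c i - wave n c j) ^ 2 /
        Real.sin (Real.pi * ((i : ℝ) - j) / n) ^ 2) -
      1 / 4 * (if i = j then 0 else wave n c i ^ 2 + wave n c j ^ 2) := by
    intro i hi j hj
    split_ifs with h
    · ring
    · have hs := sin_ne_zero_of_ne (Finset.mem_range.1 hi) (Finset.mem_range.1 hj) h
      simp only [relPert]
      have hcs := Real.cos_sq' (Real.pi * ((i : ℝ) - j) / n)
      rw [div_pow, div_pow, div_pow, mul_pow, hcs]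
      field_simp
      ring
  rw [Finset.sum_congr rfl fun i hi => Finset.sum_congr rfl fun j hj => hterm i hi j hj]
  simp only [Finset.sum_sub_distrib, Finset.sum_add_distrib, ← Finset.mul_sum]
  rw [hquad, sum_offDiag_add (fun i => wave n c i), sum_offDiag_add (fun i => wave n c i ^ 2)]
  obtain ⟨m, rfl⟩ := hn
  have hm : 0 < m := by omega
  have hm' : (m : ℝ) ≠ 0 := by positivity
  rw [sum_wave, sum_wave_sq hm]
  generalize (∑ q ∈ Finset.range (m + m), if Even q then (0 : ℝ) else (q : ℝ) *
    (((m + m : ℕ) : ℝ) - q) / Real.sin (Real.pi * q / ((m + m : ℕ) : ℝ)) ^ 4) = T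
  push_cast
  field_simp
  ring

theorem abs_log_Delta_sub_le {n : ℕ} (hn : Even n) {c : ℝ} (hc : 0 ≤ c) (hc5 : c ≤ 5)
    (h20 : 20 ≤ n) :
    0 < Delta (config n c) ∧
    |Real.log (Delta (config n c) / (n : ℝ) ^ n) -
      c ^ 2 * (8 / (n : ℝ) ^ 5 * (∑ q ∈ Finset.range n, if Even q then 0 else
        (q : ℝ) * (n - q) / Real.sin (Real.pi * q / n) ^ 4)
      - 1 / 6 * (1 - 1 / n) * (1 + 8 / (n : ℝ) ^ 2))| ≤ 1000 / (n : ℝ) := by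
  have hn' : (20 : ℝ) ≤ n := by exact_mod_cast h20
  have hn0 : (0 : ℝ) < n := by linarith
  have hw : ∀ i ∈ Finset.range n, ∀ j ∈ Finset.range n, i ≠ j → ‖relPert n c i j‖ ≤ 10 / n := by
    intro i hi j hj hij
    refine (norm_relPert_le hc (Finset.mem_range.1 hi) (Finset.mem_range.1 hj) hij).trans ?_
    gcongr
    linarith
  have hw2 : ∀ i ∈ Finset.range n, ∀ j ∈ Finset.range n, i ≠ j → ‖relPert n c i j‖ ≤ 1 / 2 := by
    intro i hi j hj hij
    refine (hw i hi j hj hij).trans ?_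
    rw [div_le_div_iff₀ hn0 two_pos]
    linarith
  have hpos : ∀ i ∈ Finset.range n, ∀ j ∈ Finset.range n,
      0 < (if i = j then 1 else ‖1 + relPert n c i j‖) := by
    intro i hi j hj
    split_ifs with h
    · exact one_pos
    · exact norm_one_add_relPert_pos (hw2 i hi j hj h)
  have hD := Delta_config_eq hn c
  have hP : 0 < ∏ i ∈ Finset.range n, ∏ j ∈ Finset.range n,
      (if i = j then 1 else ‖1 + relPert n c i j‖) :=
    Finset.prod_pos fun i hi => Finset.prod_pos fun j hj => hpos i hi j hj
  refine ⟨by rw [hD]; positivity, ?_⟩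
  rw [← sum_second_order hn (by omega) hc, hD, mul_div_cancel_left₀ _ (by positivity),
    Real.log_prod fun i hi => (Finset.prod_pos fun j hj => hpos i hi j hj).ne',
    Finset.sum_congr rfl fun i hi => Real.log_prod fun j hj => (hpos i hi j hj).ne',
    ← Finset.sum_sub_distrib]
  refine (Finset.abs_sum_le_sum_abs _ _).trans ?_
  calc _ ≤ ∑ i ∈ Finset.range n, ∑ j ∈ Finset.range n, (10 / (n : ℝ)) ^ 3 := by
        refine Finset.sum_le_sum fun i hi => ?_
        rw [← Finset.sum_sub_distrib]
        refine (Finset.abs_sum_le_sum_abs _ _).trans (Finset.sum_le_sum fun j hj => ?_)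
        split_ifs with h
        · rw [Real.log_one, sub_zero, abs_zero]; positivity
        · refine (abs_log_norm_one_add_sub_le (hw2 i hi j hj h)).trans ?_
          gcongr
          exact hw i hi j hj h
    _ = 1000 / (n : ℝ) := by
        simp only [Finset.sum_const, Finset.card_range, nsmul_eq_mul]
        field_simp
        norm_num

/-- The logarithmic form of the asymptotic formula for the explicit construction. -/
theorem abs_log_Delta_cMax_sub_le {n : ℕ} (hn : Even n) (h20 : 20 ≤ n) :
    0 < Delta (config n (cMax n)) ∧
    |Real.log (Delta (config n (cMax n)) / (n : ℝ) ^ n) - (oddCubeSum - Real.pi ^ 4 / 96)| ≤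
      3500 / (n : ℝ) := by
  have hn' : (20 : ℝ) ≤ n := by exact_mod_cast h20
  have hn0 : (0 : ℝ) < n := by linarith
  have hcm := abs_cMax_sub_le hn (by omega : 4 ≤ n)
  have h1 := pi_sq_lt
  have h2 := lt_pi_sq
  have hN : 50 / (n : ℝ) ^ 2 ≤ 1 / 8 := by
    rw [div_le_div_iff₀ (by positivity) (by norm_num)]; nlinarith
  obtain ⟨hl, hu⟩ := abs_le.1 hcm
  set c := cMax n
  have hc0 : 0 ≤ c := by linarith
  have hc5 : c ≤ 5 := by linarith
  obtain ⟨hpos, hlog⟩ := abs_log_Delta_sub_le hn hc0 hc5 h20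
  refine ⟨hpos, ?_⟩
  have hsp := spectral_sum_approx hn (by omega : 0 < n)
  set T := 8 / (n : ℝ) ^ 5 * (∑ q ∈ Finset.range n, if Even q then 0 else
        (q : ℝ) * (n - q) / Real.sin (Real.pi * q / n) ^ 4)
  set R := 1 / 6 * (1 - 1 / (n : ℝ)) * (1 + 8 / (n : ℝ) ^ 2)
  set L := Real.log (Delta (config n c) / (n : ℝ) ^ n)
  set κ := 16 * oddCubeSum / Real.pi ^ 4 - 1 / 6 with hκ
  have hinv : 0 < 1 / (n : ℝ) := by positivity
  have hinv2 : 1 / (n : ℝ) ≤ 1 / 20 := by gcongr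
  have hR : |R - 1 / 6| ≤ 1 / (n : ℝ) := by
    have e : R - 1 / 6 = (1 / (n : ℝ)) *
        (-(1 / 6) + 8 / 6 * (1 / (n : ℝ)) - 8 / 6 * (1 / (n : ℝ)) ^ 2) := by
      simp only [R]; ring
    rw [e, abs_mul, abs_of_pos hinv]
    refine mul_le_of_le_one_right hinv.le ?_
    rw [abs_le]
    constructor <;> nlinarith
  have hb : |T - R - κ| ≤ 81 / (n : ℝ) := by
    have e : T - R - κ = (T - 16 * oddCubeSum / Real.pi ^ 4) - (R - 1 / 6) := by rw [hκ]; ring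
    rw [e]
    calc _ ≤ 80 / (n : ℝ) + 1 / n := (abs_sub _ _).trans (add_le_add hsp hR)
      _ = _ := by ring
  have hκ1 : |κ| ≤ 1 := by
    obtain ⟨hz1, hz2⟩ := oddCubeSum_bounds
    have e4 : 81 ≤ Real.pi ^ 4 := by nlinarith
    have hk0 : 0 ≤ 16 * oddCubeSum / Real.pi ^ 4 := by positivity
    have hk1 : 16 * oddCubeSum / Real.pi ^ 4 ≤ 1 := by
      rw [div_le_one (by positivity)]; linarith
    rw [hκ, abs_le]
    constructor <;> linarith
  have hc2 : |c ^ 2 - Real.pi ^ 4 / 16| ≤ 400 / (n : ℝ) ^ 2 := by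
    have e : c ^ 2 - Real.pi ^ 4 / 16 = (c - Real.pi ^ 2 / 4) * (c + Real.pi ^ 2 / 4) := by ring
    rw [e, abs_mul]
    calc _ ≤ 50 / (n : ℝ) ^ 2 * 8 := by
          gcongr
          rw [abs_le]; constructor <;> linarith
      _ = _ := by ring
  have e : L - (oddCubeSum - Real.pi ^ 4 / 96) =
      (L - c ^ 2 * (T - R)) + (c ^ 2 * (T - R - κ) + (c ^ 2 - Real.pi ^ 4 / 16) * κ) := by
    have : Real.pi ^ 4 / 16 * κ = oddCubeSum - Real.pi ^ 4 / 96 := by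
      have := Real.pi_pos
      rw [hκ]; field_simp; ring
    linear_combination this
  have hA : |c ^ 2 * (T - R - κ)| ≤ 2025 / (n : ℝ) := by
    rw [abs_mul, abs_of_nonneg (by positivity)]
    calc _ ≤ 5 ^ 2 * (81 / (n : ℝ)) := by gcongr
      _ = _ := by ring
  have hB : |(c ^ 2 - Real.pi ^ 4 / 16) * κ| ≤ 20 / (n : ℝ) := by
    rw [abs_mul]
    calc _ ≤ 400 / (n : ℝ) ^ 2 * 1 := by gcongr
      _ = 400 * (1 / (n : ℝ)) * (1 / n) := by ring
      _ ≤ 400 * (1 / (n : ℝ)) * (1 / 20) := by gcongr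
      _ = _ := by ring
  have e3 : 1000 / (n : ℝ) + (2025 / n + 20 / n) ≤ 3500 / n := by
    rw [← add_div, ← add_div]; gcongr; norm_num
  rw [e]
  exact (abs_add_le _ _).trans ((add_le_add hlog ((abs_add_le _ _).trans (add_le_add hA hB))).trans e3)

/-! ### A trigonometric integral equal to the sum of the inverse odd cubes -/

theorem sinc_pos {x : ℝ} (hx : 0 ≤ x) (hx' : x ≤ Real.pi / 2) : 0 < Real.sinc x := by
  rcases hx.eq_or_lt with rfl | h
  · simp
  · rw [Real.sinc_of_ne_zero h.ne']
    exact div_pos (Real.sin_pos_of_pos_of_lt_pi h (by linarith [Real.pi_pos])) h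

theorem continuousOn_div_sinc {f : ℝ → ℝ} (hf : Continuous f) :
    ContinuousOn (fun v => f v / Real.sinc v) (Set.uIcc 0 (Real.pi / 2)) := by
  rw [Set.uIcc_of_le (by positivity)]
  exact hf.continuousOn.div Real.continuous_sinc.continuousOn
    fun x hx => (sinc_pos hx.1 hx.2).ne'

theorem continuousOn_div_sinc_sq {f : ℝ → ℝ} (hf : Continuous f) :
    ContinuousOn (fun v => f v / Real.sinc v ^ 2) (Set.uIcc 0 (Real.pi / 2)) := by
  rw [Set.uIcc_of_le (by positivity)]
  exact hf.continuousOn.div (Real.continuous_sinc.pow 2).continuousOn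
    fun x hx => (pow_pos (sinc_pos hx.1 hx.2) 2).ne'

/-- The Riemann–Lebesgue lemma for cosines on an interval. -/
theorem tendsto_integral_mul_cos {a b : ℝ} (hab : a ≤ b) {ρ : ℝ → ℝ}
    (hρ : ContinuousOn ρ (Set.uIcc a b)) {l : ℕ → ℝ} (hl : Tendsto l atTop atTop) :
    Tendsto (fun j => ∫ v in a..b, ρ v * Real.cos (l j * v)) atTop (𝓝 0) := by
  let f : ℝ → ℂ := (Set.Ioc a b).indicator fun v => (ρ v : ℂ)
  have h := Real.tendsto_integral_exp_smul_cocompact f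
  have hl' : Tendsto (fun j => l j / (2 * Real.pi)) atTop (cocompact ℝ) :=
    (hl.atTop_div_const (by positivity)).mono_right atTop_le_cocompact
  have h2 := (Complex.continuous_re.tendsto _).comp (h.comp hl')
  rw [Complex.zero_re] at h2
  refine h2.congr fun j => ?_
  simp only [Function.comp_apply]
  have e1 : ∀ v, (Real.fourierChar (-(v * (l j / (2 * Real.pi)))) • f v) =
      (Set.Ioc a b).indicator (fun v => Complex.exp ((-(l j * v) : ℝ) * Complex.I) * (ρ v : ℂ)) v := by
    intro v
    rw [Circle.smul_def, Real.fourierChar_apply, smul_eq_mul]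
    by_cases hv : v ∈ Set.Ioc a b
    · simp only [f, Set.indicator_of_mem hv]
      congr 4
      field_simp
    · simp only [f, Set.indicator_of_notMem hv, mul_zero]
  simp only [e1]
  rw [integral_indicator measurableSet_Ioc, ← intervalIntegral.integral_of_le hab]
  have hint : IntervalIntegrable
      (fun v => Complex.exp ((-(l j * v) : ℝ) * Complex.I) * (ρ v : ℂ)) volume a b := by
    apply ContinuousOn.intervalIntegrable
    exact (Continuous.continuousOn (by fun_prop)).mul (Complex.continuous_ofReal.comp_continuousOn hρ)
  have := Complex.reCLM.intervalIntegral_comp_comm hint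
  simp only [Complex.reCLM_apply] at this
  rw [← this]
  refine intervalIntegral.integral_congr fun v _ => ?_
  simp only [Complex.re_mul_ofReal, Complex.exp_ofReal_mul_I_re, Real.cos_neg]
  ring

theorem integral_parabola_mul_sin {k : ℕ} (hk : k ≠ 0) :
    ∫ v in (0 : ℝ)..(Real.pi / 2), 6 * v * (Real.pi / 2 - v) * Real.sin (2 * k * v) =
      3 / 2 * (1 - (-1) ^ k) / (k : ℝ) ^ 3 := by
  have hk' : (k : ℝ) ≠ 0 := by exact_mod_cast hk
  have hderiv : ∀ v : ℝ, HasDerivAt (fun v => -(6 * v * (Real.pi / 2 - v)) *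
      Real.cos (2 * k * v) / (2 * k) + (3 * Real.pi - 12 * v) * Real.sin (2 * k * v) / (2 * k) ^ 2
      - 12 * Real.cos (2 * k * v) / (2 * k) ^ 3)
      (6 * v * (Real.pi / 2 - v) * Real.sin (2 * k * v)) v := by
    intro v
    have h1 : HasDerivAt (fun v : ℝ => 2 * (k : ℝ) * v) (2 * k) v := by
      simpa using (hasDerivAt_id v).const_mul (2 * (k : ℝ))
    have hs := h1.sin
    have hc := h1.cos
    have hp : HasDerivAt (fun v : ℝ => -(6 * v * (Real.pi / 2 - v)))
        (-(3 * Real.pi - 12 * v)) v := by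
      have := (((hasDerivAt_id v).const_mul 6).mul ((hasDerivAt_id v).const_sub (Real.pi / 2))).neg
      refine this.congr_deriv ?_
      simp only [id]
      ring
    have hq : HasDerivAt (fun v : ℝ => 3 * Real.pi - 12 * v) (-12) v := by
      simpa using ((hasDerivAt_id v).const_mul 12).const_sub (3 * Real.pi)
    have := (((hp.mul hc).div_const (2 * (k : ℝ))).add
      ((hq.mul hs).div_const ((2 * (k : ℝ)) ^ 2))).sub
      ((hc.const_mul 12).div_const ((2 * (k : ℝ)) ^ 3))
    refine this.congr_deriv ?_
    field_simp
    ring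
  rw [intervalIntegral.integral_eq_sub_of_hasDerivAt (fun v _ => hderiv v)
    (Continuous.intervalIntegrable (by fun_prop) _ _)]
  have e : 2 * (k : ℝ) * (Real.pi / 2) = k * Real.pi := by ring
  rw [e, Real.sin_nat_mul_pi, Real.cos_nat_mul_pi]
  simp only [mul_zero, Real.cos_zero, Real.sin_zero]
  field_simp
  ring

/-- The integral of `6v(π/2 - v) cot v`. The kernels `cos((4j+1)v)/sin v` interpolate between `cot`
and, by the Riemann–Lebesgue lemma, zero; each step contributes one odd inverse cube. -/
theorem integral_parabola_mul_cot :
    ∫ v in (0 : ℝ)..(Real.pi / 2), 6 * (Real.pi / 2 - v) * Real.cos v / Real.sinc v =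
      6 * oddCubeSum := by
  set ρ : ℝ → ℝ := fun v => 6 * (Real.pi / 2 - v) / Real.sinc v with hρ
  have hρc : ContinuousOn ρ (Set.uIcc 0 (Real.pi / 2)) := continuousOn_div_sinc (by fun_prop)
  set r : ℕ → ℝ := fun j => ∫ v in (0 : ℝ)..(Real.pi / 2), ρ v * Real.cos ((4 * (j : ℝ) + 1) * v)
    with hr
  have hint : ∀ l : ℝ, IntervalIntegrable (fun v => ρ v * Real.cos (l * v)) volume 0 (Real.pi / 2) :=
    fun l => (hρc.mul (Continuous.continuousOn (by fun_prop))).intervalIntegrable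
  have hlim : Tendsto r atTop (𝓝 0) := by
    refine tendsto_integral_mul_cos (by positivity) hρc ?_
    exact tendsto_atTop_add_const_right _ _
      (tendsto_natCast_atTop_atTop.const_mul_atTop (by norm_num))
  have hstep : ∀ j, r j - r (j + 1) = 6 * (1 / (2 * (j : ℝ) + 1) ^ 3) := by
    intro j
    have h1 := integral_parabola_mul_sin (k := 2 * j + 1) (by omega)
    have h2 := integral_parabola_mul_sin (k := 2 * j + 2) (by omega)
    rw [Odd.neg_one_pow ⟨j, rfl⟩] at h1
    rw [Even.neg_one_pow ⟨j + 1, by ring⟩] at h2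
    have h3 : r j - r (j + 1) = 2 * ((∫ v in (0 : ℝ)..(Real.pi / 2),
        6 * v * (Real.pi / 2 - v) * Real.sin (2 * (2 * j + 1 : ℕ) * v)) +
        ∫ v in (0 : ℝ)..(Real.pi / 2),
        6 * v * (Real.pi / 2 - v) * Real.sin (2 * (2 * j + 2 : ℕ) * v)) := by
      simp only [hr]
      rw [← intervalIntegral.integral_sub (hint _) (hint _), ← intervalIntegral.integral_add
        (Continuous.intervalIntegrable (by fun_prop) _ _)
        (Continuous.intervalIntegrable (by fun_prop) _ _), ← intervalIntegral.integral_const_mul]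
      refine intervalIntegral.integral_congr_ae (ae_of_all _ fun v hv => ?_)
      rw [Set.uIoc_of_le (by positivity)] at hv
      have hs : Real.sin v ≠ 0 :=
        (Real.sin_pos_of_pos_of_lt_pi hv.1 (by linarith [Real.pi_pos, hv.2])).ne'
      have e1 : 2 * Real.sin v * (Real.sin (2 * (2 * j + 1 : ℕ) * v) +
          Real.sin (2 * (2 * j + 2 : ℕ) * v)) =
          Real.cos ((4 * (j : ℝ) + 1) * v) - Real.cos ((4 * ((j + 1 : ℕ) : ℝ) + 1) * v) := by
        have a1 := Real.cos_sub_cos ((4 * (j : ℝ) + 1) * v) ((4 * (j : ℝ) + 3) * v)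
        have a2 := Real.cos_sub_cos ((4 * (j : ℝ) + 3) * v) ((4 * ((j + 1 : ℕ) : ℝ) + 1) * v)
        rw [show ((4 * (j : ℝ) + 1) * v + (4 * (j : ℝ) + 3) * v) / 2 = 2 * (2 * j + 1 : ℕ) * v by
            push_cast; ring,
          show ((4 * (j : ℝ) + 1) * v - (4 * (j : ℝ) + 3) * v) / 2 = -v by ring, Real.sin_neg] at a1
        rw [show ((4 * (j : ℝ) + 3) * v + (4 * ((j + 1 : ℕ) : ℝ) + 1) * v) / 2 =
            2 * (2 * j + 2 : ℕ) * v by push_cast; ring,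
          show ((4 * (j : ℝ) + 3) * v - (4 * ((j + 1 : ℕ) : ℝ) + 1) * v) / 2 = -v by
            push_cast; ring, Real.sin_neg] at a2
        linear_combination -a1 - a2
      simp only [hρ]
      rw [← mul_sub, ← e1, Real.sinc_of_ne_zero hv.1.ne']
      have := hv.1.ne'
      field_simp
    rw [h3, h1, h2]
    push_cast
    field_simp
    ring
  have hr0 : r 0 = ∫ v in (0 : ℝ)..(Real.pi / 2),
      6 * (Real.pi / 2 - v) * Real.cos v / Real.sinc v := by
    simp only [hr, hρ]
    refine intervalIntegral.integral_congr fun v _ => ?_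
    simp only [Nat.cast_zero, mul_zero, zero_add, one_mul]
    ring
  rw [← hr0]
  have htel : ∀ N : ℕ, r 0 - r N = 6 * ∑ k ∈ Finset.range N, 1 / (2 * (k : ℝ) + 1) ^ 3 := by
    intro N
    induction N with
    | zero => simp
    | succ N ih => rw [Finset.sum_range_succ, mul_add, ← ih, ← hstep]; ring
  have l1 : Tendsto (fun N => r 0 - r N) atTop (𝓝 (r 0 - 0)) := hlim.const_sub _
  have l2 : Tendsto (fun N => r 0 - r N) atTop (𝓝 (6 * oddCubeSum)) := by
    simp only [htel]
    exact summable_oddCube.hasSum.tendsto_sum_nat.const_mul 6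
  rw [sub_zero] at l1
  exact tendsto_nhds_unique l1 l2

/-- Integration by parts moves the double pole of `1/sin²` to the simple pole of `cot`. -/
theorem integral_linear_div_sinc_sq :
    ∫ v in (0 : ℝ)..(Real.pi / 2), (3 * Real.pi / 2 - 2 * v) / Real.sinc v ^ 2 =
      6 * oddCubeSum := by
  rw [← integral_parabola_mul_cot, ← sub_eq_zero, ← neg_eq_zero, neg_sub]
  have hpi : (0 : ℝ) ≤ Real.pi / 2 := by positivity
  have c1 : ContinuousOn (fun v => 6 * (Real.pi / 2 - v) * Real.cos v / Real.sinc v)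
      (Set.uIcc 0 (Real.pi / 2)) := continuousOn_div_sinc (by fun_prop)
  have c2 : ContinuousOn (fun v => (3 * Real.pi / 2 - 2 * v) / Real.sinc v ^ 2)
      (Set.uIcc 0 (Real.pi / 2)) := continuousOn_div_sinc_sq (by fun_prop)
  have c3 : ContinuousOn (fun v => (3 * Real.pi / 2 * v - 2 * v ^ 2) * Real.cos v / Real.sinc v)
      (Set.uIcc 0 (Real.pi / 2)) := continuousOn_div_sinc (by fun_prop)
  rw [← intervalIntegral.integral_sub c1.intervalIntegrable c2.intervalIntegrable,
    intervalIntegral.integral_eq_sub_of_hasDerivAt_of_le hpi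
      (by rwa [Set.uIcc_of_le hpi] at c3) ?_ (c1.intervalIntegrable.sub c2.intervalIntegrable)]
  · simp
  · intro v hv
    have hv0 : v ≠ 0 := hv.1.ne'
    have hs : Real.sin v ≠ 0 :=
      (Real.sin_pos_of_pos_of_lt_pi hv.1 (by linarith [Real.pi_pos, hv.2])).ne'
    have hd : HasDerivAt (fun v => (3 * Real.pi / 2 * v ^ 2 - 2 * v ^ 3) * Real.cos v / Real.sin v)
        (6 * (Real.pi / 2 - v) * Real.cos v / Real.sinc v -
          (3 * Real.pi / 2 - 2 * v) / Real.sinc v ^ 2) v := by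
      have hp : HasDerivAt (fun v : ℝ => 3 * Real.pi / 2 * v ^ 2 - 2 * v ^ 3)
          (3 * Real.pi * v - 6 * v ^ 2) v := by
        have := ((hasDerivAt_pow 2 v).const_mul (3 * Real.pi / 2)).sub
          ((hasDerivAt_pow 3 v).const_mul 2)
        refine this.congr_deriv ?_
        push_cast
        ring
      have := (hp.mul (Real.hasDerivAt_cos v)).div (Real.hasDerivAt_sin v) hs
      refine this.congr_deriv ?_
      simp only [Pi.mul_apply]
      rw [Real.sinc_of_ne_zero hv0]
      have hsc := Real.sin_sq_add_cos_sq v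
      field_simp
      linear_combination (-(v * (3 * Real.pi - 4 * v))) * hsc
    refine hd.congr_of_eventuallyEq ?_
    filter_upwards [isOpen_ne.mem_nhds hv0] with w hw
    rw [Real.sinc_of_ne_zero hw]
    have hw' : w ≠ 0 := hw
    field_simp

/-! ### The integrand of `I` -/

/-- In the half difference `u = (x - y)/2` the integrand is elementary, with a double pole of
`1/sin² u` that the numerator cancels. -/
theorem integrand_eq {x y : ℝ} (hs : Real.sin ((x - y) / 2) ≠ 0) :
    integrand x y =
      ((-(((1 - x / Real.pi) ^ 2 + (1 - y / Real.pi) ^ 2) * Real.cos ((x - y) / 2)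
          - 2 * (1 - x / Real.pi) * (1 - y / Real.pi)) *
          Real.cos ((x - y) / 2) / (2 * Real.sin ((x - y) / 2) ^ 2) : ℝ) : ℂ) +
      ((-((1 - x / Real.pi) ^ 2 - (1 - y / Real.pi) ^ 2) *
          Real.cos ((x - y) / 2) / (2 * Real.sin ((x - y) / 2)) : ℝ) : ℂ) * Complex.I := by
  set u := (x - y) / 2 with hu
  set p := Complex.exp (Complex.I * (x : ℂ) / 2) with hp
  set r := Complex.exp (Complex.I * (y : ℂ) / 2) with hr
  have hp0 : p ≠ 0 := Complex.exp_ne_zero _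
  have hr0 : r ≠ 0 := Complex.exp_ne_zero _
  have hpp : Complex.exp (Complex.I * (x : ℂ)) = p ^ 2 := by
    rw [hp, ← Complex.exp_nat_mul]; congr 1; push_cast; ring
  have hrr : Complex.exp (Complex.I * (y : ℂ)) = r ^ 2 := by
    rw [hr, ← Complex.exp_nat_mul]; congr 1; push_cast; ring
  have hw : p = r * (Real.cos u + Real.sin u * Complex.I) := by
    rw [← Complex.exp_ofReal_mul_I_re u, ← Complex.exp_ofReal_mul_I_im u, Complex.re_add_im, hp, hr,
      ← Complex.exp_add, hu]
    congr 1; push_cast; ring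
  have hsc : ((Real.sin u : ℝ) : ℂ) ^ 2 + ((Real.cos u : ℝ) : ℂ) ^ 2 = 1 := by
    exact_mod_cast Real.sin_sq_add_cos_sq u
  have hsC : ((Real.sin u : ℝ) : ℂ) ≠ 0 := by exact_mod_cast hs
  rw [integrand, ← hp, ← hr, hpp, hrr]
  have hpi : (Real.pi : ℂ) ≠ 0 := by exact_mod_cast Real.pi_ne_zero
  push_cast
  simp only [← Complex.ofReal_cos, ← Complex.ofReal_sin]
  generalize (1 : ℂ) - x / Real.pi = a
  generalize (1 : ℂ) - y / Real.pi = b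
  generalize ((Real.cos u : ℝ) : ℂ) = C at *
  generalize ((Real.sin u : ℝ) : ℂ) = S at *
  have hI := Complex.I_sq
  have e1 : p ^ 2 + r ^ 2 = 2 * C * (p * r) := by
    rw [hw]; linear_combination (-(r ^ 2)) * hsc + r ^ 2 * S ^ 2 * hI
  have e2 : p ^ 2 - r ^ 2 = 2 * S * Complex.I * (p * r) := by
    rw [hw]; linear_combination (r ^ 2) * hsc - r ^ 2 * S ^ 2 * hI
  have e3 : (a * p - b * r) ^ 2 =
      ((a ^ 2 + b ^ 2) * C - 2 * a * b + (a ^ 2 - b ^ 2) * S * Complex.I) * (p * r) := by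
    linear_combination (a ^ 2 / 2) * (e1 + e2) + (b ^ 2 / 2) * (e1 - e2)
  rw [e1, e2, e3, mul_pow, mul_pow, mul_pow, hI]
  field_simp
  ring

theorem norm_integrand_le {x y : ℝ} (hx : x ∈ Set.Icc 0 (2 * Real.pi))
    (hy : y ∈ Set.Icc 0 (2 * Real.pi)) : ‖integrand x y‖ ≤ 1 := by
  have hpi := Real.pi_pos
  obtain ⟨hx0, hx1⟩ := hx
  obtain ⟨hy0, hy1⟩ := hy
  set u := (x - y) / 2 with hu
  have hden : ‖Complex.exp (Complex.I * (x : ℂ)) - Complex.exp (Complex.I * (y : ℂ))‖ ^ 2 =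
      4 * Real.sin u ^ 2 := by
    have := norm_sq_polar_sub 1 1 x y
    rw [Complex.ofReal_one, one_mul, one_mul, mul_comm (x : ℂ), mul_comm (y : ℂ)] at this
    rw [this, hu]; ring
  set a := 1 - x / Real.pi with ha
  set b := 1 - y / Real.pi with hb
  have hnum : ‖(1 - (x : ℂ) / (Real.pi : ℂ)) * Complex.exp (Complex.I * (x : ℂ) / 2)
      - (1 - (y : ℂ) / (Real.pi : ℂ)) * Complex.exp (Complex.I * (y : ℂ) / 2)‖ ^ 2 =
      (a - b) ^ 2 * Real.cos (u / 2) ^ 2 + (a + b) ^ 2 * Real.sin (u / 2) ^ 2 := by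
    have := norm_sq_polar_sub a b (x / 2) (y / 2)
    rw [show (x / 2 - y / 2) / 2 = u / 2 by rw [hu]; ring] at this
    rw [← this, ha, hb]
    congr 4
    · push_cast; ring
    · congr 1; push_cast; ring
    · push_cast; ring
    · congr 1; push_cast; ring
  have hsum : ‖Complex.exp (Complex.I * (x : ℂ)) + Complex.exp (Complex.I * (y : ℂ))‖ ≤ 2 := by
    refine (norm_add_le _ _).trans ?_
    rw [mul_comm Complex.I, mul_comm Complex.I, Complex.norm_exp_ofReal_mul_I,
      Complex.norm_exp_ofReal_mul_I]
    norm_num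
  have hua : |u| ≤ Real.pi := by rw [hu, abs_le]; constructor <;> linarith
  -- Jordan's inequality for `sin |u/2|` and for `cos |u/2| = sin (π/2 - |u/2|)`
  have hj1 : |u| / Real.pi ≤ Real.sin (|u| / 2) := by
    have := Real.mul_le_sin (x := |u| / 2) (by positivity) (by linarith)
    calc _ = 2 / Real.pi * (|u| / 2) := by ring
      _ ≤ _ := this
  have hj2 : 1 - |u| / Real.pi ≤ Real.cos (|u| / 2) := by
    have := Real.one_sub_mul_le_cos (x := |u| / 2) (by positivity) (by linarith)
    calc _ = 1 - 2 / Real.pi * (|u| / 2) := by ring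
      _ ≤ _ := this
  have hu1 : |u| / Real.pi ≤ 1 := by rw [div_le_one hpi]; exact hua
  have hs2 : Real.sin (|u| / 2) ^ 2 = Real.sin (u / 2) ^ 2 := by
    rcases abs_choice u with h | h <;> rw [h]
    rw [neg_div, Real.sin_neg, neg_sq]
  have hc2 : Real.cos (|u| / 2) ^ 2 = Real.cos (u / 2) ^ 2 := by
    rcases abs_choice u with h | h <;> rw [h]
    rw [neg_div, Real.cos_neg]
  have hab : (a - b) ^ 2 ≤ 4 * Real.sin (u / 2) ^ 2 := by
    have e : a - b = -2 * (u / Real.pi) := by rw [ha, hb, hu]; ring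
    rw [e, ← hs2]
    calc (-2 * (u / Real.pi)) ^ 2 = 4 * (|u| / Real.pi) ^ 2 := by rw [div_pow, sq_abs]; ring
      _ ≤ _ := by gcongr
  have hab' : (a + b) ^ 2 ≤ 4 * Real.cos (u / 2) ^ 2 := by
    rw [← hc2]
    have e : |a + b| ≤ 2 * (1 - |u| / Real.pi) := by
      have e1 : a + b = 2 - (x + y) / Real.pi := by rw [ha, hb]; ring
      have h1 : 2 * |u| ≤ x + y := by
        rw [hu, abs_div, abs_two, mul_div_cancel₀ _ two_ne_zero, abs_le]
        constructor <;> linarith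
      have h2 : 2 * |u| ≤ 4 * Real.pi - (x + y) := by
        rw [hu, abs_div, abs_two, mul_div_cancel₀ _ two_ne_zero, abs_le]
        constructor <;> linarith
      have h1' : 2 * |u| / Real.pi ≤ (x + y) / Real.pi := by gcongr
      have h2' : 2 * |u| / Real.pi ≤ (4 * Real.pi - (x + y)) / Real.pi := by gcongr
      rw [sub_div, mul_div_cancel_right₀ _ hpi.ne'] at h2'
      rw [mul_div_assoc] at h1' h2'
      rw [e1, abs_le]
      constructor <;> linarith
    calc (a + b) ^ 2 = |a + b| ^ 2 := (sq_abs _).symm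
      _ ≤ (2 * (1 - |u| / Real.pi)) ^ 2 := by gcongr
      _ = 4 * (1 - |u| / Real.pi) ^ 2 := by ring
      _ ≤ _ := by gcongr
  have hsin : Real.sin u ^ 2 = 4 * Real.sin (u / 2) ^ 2 * Real.cos (u / 2) ^ 2 := by
    conv_lhs => rw [show u = 2 * (u / 2) by ring, Real.sin_two_mul]
    ring
  rw [integrand, norm_div, norm_mul, norm_pow, norm_pow, hnum, hden]
  refine div_le_one_of_le₀ ?_ (by positivity)
  calc _ ≤ (4 * Real.sin (u / 2) ^ 2 * Real.cos (u / 2) ^ 2 +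
        4 * Real.cos (u / 2) ^ 2 * Real.sin (u / 2) ^ 2) * 2 := by gcongr
    _ = 4 * Real.sin u ^ 2 := by rw [hsin]; ring

theorem measurable_integrand : Measurable fun p : ℝ × ℝ => integrand p.1 p.2 := by
  unfold integrand
  fun_prop

theorem integrableOn_integrand :
    IntegrableOn (fun p : ℝ × ℝ => integrand p.1 p.2)
      (Set.Icc 0 (2 * Real.pi) ×ˢ Set.Icc 0 (2 * Real.pi)) volume := by
  have hfin : volume (Set.Icc (0 : ℝ) (2 * Real.pi) ×ˢ Set.Icc (0 : ℝ) (2 * Real.pi)) ≠ ⊤ :=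
    (isCompact_Icc.prod isCompact_Icc).measure_ne_top
  refine Measure.integrableOn_of_bounded hfin measurable_integrand.aestronglyMeasurable (M := 1) ?_
  filter_upwards [ae_restrict_mem (measurableSet_Icc.prod measurableSet_Icc)] with p hp
  exact norm_integrand_le hp.1 hp.2

theorem integrand_symm (x y : ℝ) : integrand x y = integrand y x := by
  simp only [integrand]
  congr 1 <;> ring

/-! ### Reduction of `I` to a single integral -/

/-- The integrand cut off to the half-open square. -/
noncomputable def cutIntegrand (x y : ℝ) : ℂ :=
  if (x ∈ Set.Ioc 0 (2 * Real.pi)) ∧ (y ∈ Set.Ioc 0 (2 * Real.pi)) then integrand x y else 0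

theorem cutIntegrand_symm (x y : ℝ) : cutIntegrand x y = cutIntegrand y x := by
  simp only [cutIntegrand, integrand_symm x y, and_comm]

theorem integrable_cutIntegrand : Integrable fun p : ℝ × ℝ => cutIntegrand p.1 p.2 := by
  have h : (fun p : ℝ × ℝ => cutIntegrand p.1 p.2) =
      (Set.Ioc 0 (2 * Real.pi) ×ˢ Set.Ioc 0 (2 * Real.pi)).indicator
        fun p : ℝ × ℝ => integrand p.1 p.2 := by
    ext p
    simp only [cutIntegrand, Set.indicator_apply, Set.mem_prod]
  rw [h, integrable_indicator_iff (measurableSet_Ioc.prod measurableSet_Ioc)]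
  exact integrableOn_integrand.mono_set
    (Set.prod_mono Set.Ioc_subset_Icc_self Set.Ioc_subset_Icc_self)

theorem doubleIntegral_eq_cut : doubleIntegral = ∫ y, ∫ x, cutIntegrand x y := by
  have hpi : (0 : ℝ) ≤ 2 * Real.pi := by positivity
  rw [doubleIntegral, intervalIntegral.integral_of_le hpi, ← integral_indicator measurableSet_Ioc]
  refine integral_congr_ae (ae_of_all _ fun y => ?_)
  simp only [Set.indicator_apply]
  split_ifs with hy
  · rw [intervalIntegral.integral_of_le hpi, ← integral_indicator measurableSet_Ioc]
    refine integral_congr_ae (ae_of_all _ fun x => ?_)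
    simp only [Set.indicator_apply, cutIntegrand, hy, and_true]
  · simp [cutIntegrand, hy]

/-- The integral of the integrand along the line `x - y = t`. -/
noncomputable def lineIntegral (t : ℝ) : ℂ := ∫ y, cutIntegrand (t + y) y

theorem integrable_shear : Integrable fun p : ℝ × ℝ => cutIntegrand (p.2 + p.1) p.1 := by
  have h := (measurePreserving_prod_add_right (volume : Measure ℝ) (volume : Measure ℝ))
  have h2 : Integrable (fun p : ℝ × ℝ => cutIntegrand p.2 p.1) := integrable_cutIntegrand.swap
  exact h.integrable_comp_of_integrable h2

theorem doubleIntegral_eq_integral_lineIntegral : doubleIntegral = ∫ t, lineIntegral t := by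
  rw [doubleIntegral_eq_cut]
  have h : ∀ y, ∫ x, cutIntegrand x y = ∫ t, cutIntegrand (t + y) y := fun y =>
    (integral_add_right_eq_self (fun x => cutIntegrand x y) y).symm
  simp only [h]
  exact integral_integral_swap (f := fun y t => cutIntegrand (t + y) y) integrable_shear

theorem integrable_lineIntegral : Integrable lineIntegral :=
  integrable_shear.integral_prod_right

theorem lineIntegral_neg (t : ℝ) : lineIntegral (-t) = lineIntegral t := by
  rw [lineIntegral, ← integral_add_right_eq_self _ t, lineIntegral]
  refine integral_congr_ae (ae_of_all _ fun y => ?_)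
  simp only
  rw [cutIntegrand_symm]
  congr 1 <;> ring

theorem doubleIntegral_eq_two_mul :
    doubleIntegral = 2 * ∫ t in Set.Ioi 0, lineIntegral t := by
  have h := integral_comp_neg_Iic 0 lineIntegral
  simp only [lineIntegral_neg, neg_zero] at h
  rw [doubleIntegral_eq_integral_lineIntegral, ← intervalIntegral.integral_Iic_add_Ioi
    integrable_lineIntegral.integrableOn integrable_lineIntegral.integrableOn (b := 0), h, two_mul]

theorem lineIntegral_eq_zero {t : ℝ} (ht : 2 * Real.pi ≤ t) : lineIntegral t = 0 := by
  rw [lineIntegral]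
  refine integral_eq_zero_of_ae (ae_of_all _ fun y => if_neg ?_)
  rintro ⟨h1, h2⟩
  linarith [h1.2, h2.1]

theorem lineIntegral_eq {t : ℝ} (ht : t ∈ Set.Ioo 0 (2 * Real.pi)) :
    lineIntegral t = ((-(Real.pi / 4) * Real.cos (t / 2) / Real.sin (t / 2) ^ 2 *
      ((Real.cos (t / 2) - 1) * (2 - t / Real.pi) ^ 3 / 3 +
        (Real.cos (t / 2) + 1) * (t / Real.pi) ^ 2 * (2 - t / Real.pi)) : ℝ) : ℂ) := by
  obtain ⟨ht0, ht1⟩ := ht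
  have hpi := Real.pi_pos
  have hs : Real.sin (t / 2) ≠ 0 := (Real.sin_pos_of_pos_of_lt_pi (by linarith) (by linarith)).ne'
  have h1 : lineIntegral t = ∫ y in (0 : ℝ)..(2 * Real.pi - t), integrand (t + y) y := by
    rw [lineIntegral, intervalIntegral.integral_of_le (by linarith),
      ← integral_indicator measurableSet_Ioc]
    refine integral_congr_ae (ae_of_all _ fun y => ?_)
    simp only [Set.indicator_apply, cutIntegrand]
    refine if_congr ?_ rfl rfl
    simp only [Set.mem_Ioc]
    constructor
    · rintro ⟨⟨-, h2⟩, h3, -⟩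
      exact ⟨h3, by linarith⟩
    · rintro ⟨h2, h3⟩
      exact ⟨⟨by linarith, by linarith⟩, h2, by linarith⟩
  rw [h1]
  set d := t / Real.pi with hd
  have htd : t = Real.pi * d := by rw [hd]; field_simp
  set C := Real.cos (t / 2)
  set S := Real.sin (t / 2)
  -- `s = a + b` is the sum of the two linear factors; `a - b = -d` is constant along the line.
  set s : ℝ → ℝ := fun y => 2 - d - 2 * y / Real.pi with hsdef
  have h2 : ∀ y, integrand (t + y) y =
      ((-(C / (4 * S ^ 2)) * ((C - 1) * s y ^ 2 + (C + 1) * d ^ 2) : ℝ) : ℂ) +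
      ((C / (2 * S) * d * s y : ℝ) : ℂ) * Complex.I := by
    intro y
    rw [integrand_eq (by rwa [add_sub_cancel_right]), add_sub_cancel_right,
      show Real.cos (t / 2) = C from rfl, show Real.sin (t / 2) = S from rfl]
    clear_value C S
    congr 2
    · simp only [hsdef, hd]
      field_simp
      ring
    · congr 1
      simp only [hsdef, hd]
      field_simp
      ring
  have hds : ∀ y, HasDerivAt s (-(2 / Real.pi)) y := by
    intro y
    have := (((hasDerivAt_id y).const_mul 2).div_const Real.pi).const_sub (2 - d)
    simpa [hsdef] using this
  have hsc : Continuous s := by fun_prop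
  have e0 : s 0 = 2 - d := by simp [hsdef]
  have e1 : s (2 * Real.pi - t) = -(2 - d) := by
    simp only [hsdef]
    rw [htd]
    field_simp
    ring
  have i1 : ∫ y in (0 : ℝ)..(2 * Real.pi - t), s y = 0 := by
    have hderiv : ∀ y, HasDerivAt (fun y => -(Real.pi / 4) * s y ^ 2) (s y) y := by
      intro y
      refine (((hds y).pow 2).const_mul (-(Real.pi / 4))).congr_deriv ?_
      push_cast
      field_simp
      ring
    rw [intervalIntegral.integral_eq_sub_of_hasDerivAt (fun y _ => hderiv y)
      (hsc.intervalIntegrable _ _), e0, e1]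
    ring
  have i2 : ∫ y in (0 : ℝ)..(2 * Real.pi - t), s y ^ 2 = Real.pi / 3 * (2 - d) ^ 3 := by
    have hderiv : ∀ y, HasDerivAt (fun y => -(Real.pi / 6) * s y ^ 3) (s y ^ 2) y := by
      intro y
      refine (((hds y).pow 3).const_mul (-(Real.pi / 6))).congr_deriv ?_
      push_cast
      field_simp
      ring
    rw [intervalIntegral.integral_eq_sub_of_hasDerivAt (fun y _ => hderiv y)
      ((hsc.pow 2).intervalIntegrable _ _), e0, e1]
    ring
  simp only [h2]
  rw [intervalIntegral.integral_add (Continuous.intervalIntegrable (by fun_prop) _ _)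
    (Continuous.intervalIntegrable (by fun_prop) _ _), intervalIntegral.integral_mul_const,
    intervalIntegral.integral_ofReal, intervalIntegral.integral_ofReal,
    intervalIntegral.integral_const_mul, intervalIntegral.integral_const_mul, i1,
    intervalIntegral.integral_add
      (show IntervalIntegrable (fun y => (C - 1) * s y ^ 2) volume 0 (2 * Real.pi - t) from
        Continuous.intervalIntegrable (by fun_prop) _ _)
      (continuous_const.intervalIntegrable _ _), intervalIntegral.integral_const_mul, i2,
    intervalIntegral.integral_const, mul_zero, Complex.ofReal_zero, zero_mul, add_zero]
  congr 1
  rw [smul_eq_mul, sub_zero, htd]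
  field_simp

/-! ### Evaluation of `I` and of `C` -/

theorem integral_linear_mul_cos_div_sinc_sq :
    ∫ v in (0 : ℝ)..(Real.pi / 2), (3 * Real.pi / 2 - 2 * v) * Real.cos (2 * v) / Real.sinc v ^ 2 =
      6 * oddCubeSum - Real.pi ^ 4 / 16 := by
  have hpi : (0 : ℝ) ≤ Real.pi / 2 := by positivity
  have h : ∀ v ∈ Set.uIcc 0 (Real.pi / 2),
      (3 * Real.pi / 2 - 2 * v) * Real.cos (2 * v) / Real.sinc v ^ 2 =
      (3 * Real.pi / 2 - 2 * v) / Real.sinc v ^ 2 - (3 * Real.pi * v ^ 2 - 4 * v ^ 3) := by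
    intro v hv
    rw [Set.uIcc_of_le hpi] at hv
    have hs := (sinc_pos hv.1 hv.2).ne'
    have hsin : Real.sin v = v * Real.sinc v := by
      by_cases h0 : v = 0
      · simp [h0]
      · rw [Real.sinc_of_ne_zero h0]; field_simp
    rw [Real.cos_two_mul, Real.cos_sq', hsin]
    field_simp
    ring
  rw [intervalIntegral.integral_congr h, intervalIntegral.integral_sub
    (continuousOn_div_sinc_sq (by fun_prop)).intervalIntegrable
    (Continuous.intervalIntegrable (by fun_prop) _ _), integral_linear_div_sinc_sq]
  have hderiv : ∀ v : ℝ, HasDerivAt (fun v => Real.pi * v ^ 3 - v ^ 4)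
      (3 * Real.pi * v ^ 2 - 4 * v ^ 3) v := by
    intro v
    refine (((hasDerivAt_pow 3 v).const_mul Real.pi).sub (hasDerivAt_pow 4 v)).congr_deriv ?_
    push_cast
    ring
  rw [intervalIntegral.integral_eq_sub_of_hasDerivAt (fun v _ => hderiv v)
    (Continuous.intervalIntegrable (by fun_prop) _ _)]
  ring

theorem integral_line_formula :
    ∫ t in (0 : ℝ)..(2 * Real.pi), (-(Real.pi / 4) * Real.cos (t / 2) / Real.sin (t / 2) ^ 2 *
      ((Real.cos (t / 2) - 1) * (2 - t / Real.pi) ^ 3 / 3 +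
        (Real.cos (t / 2) + 1) * (t / Real.pi) ^ 2 * (2 - t / Real.pi))) =
      4 * (-(8 / (3 * Real.pi ^ 2)) * (6 * oddCubeSum - Real.pi ^ 4 / 16)) := by
  have hpi := Real.pi_pos
  have hpi2 : (0 : ℝ) ≤ Real.pi / 2 := by positivity
  set g : ℝ → ℝ := fun t => (-(Real.pi / 4) * Real.cos (t / 2) / Real.sin (t / 2) ^ 2 *
      ((Real.cos (t / 2) - 1) * (2 - t / Real.pi) ^ 3 / 3 +
        (Real.cos (t / 2) + 1) * (t / Real.pi) ^ 2 * (2 - t / Real.pi))) with hg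
  have hsub := intervalIntegral.integral_comp_mul_left g (a := 0) (b := Real.pi / 2)
    (by norm_num : (4 : ℝ) ≠ 0)
  rw [mul_zero, show 4 * (Real.pi / 2) = 2 * Real.pi by ring, smul_eq_mul] at hsub
  have hsub' : ∫ t in (0 : ℝ)..(2 * Real.pi), g t =
      4 * ∫ v in (0 : ℝ)..(Real.pi / 2), g (4 * v) := by rw [hsub]; ring
  rw [hsub', ← integral_linear_mul_cos_div_sinc_sq]
  congr 1
  -- The pole at `v = π/2` is moved to the origin by the reflection `v ↦ π/2 - v`.
  set ψ₁ : ℝ → ℝ := fun v => (-(8 / (3 * Real.pi ^ 2)) * v * Real.cos (2 * v)) / Real.sinc v ^ 2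
    with hψ₁
  set ψ₂ : ℝ → ℝ := fun v => (-(8 / Real.pi ^ 2) * (Real.pi / 2 - v) * Real.cos (2 * v)) /
    Real.sinc v ^ 2 with hψ₂
  have c1 : ContinuousOn ψ₁ (Set.uIcc 0 (Real.pi / 2)) := continuousOn_div_sinc_sq (by fun_prop)
  have c2 : ContinuousOn ψ₂ (Set.uIcc 0 (Real.pi / 2)) := continuousOn_div_sinc_sq (by fun_prop)
  have c1' : IntervalIntegrable (fun v => ψ₁ (Real.pi / 2 - v)) volume 0 (Real.pi / 2) := by
    have := c1.intervalIntegrable.comp_sub_left (Real.pi / 2)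
    simpa using this.symm
  have hdecomp : ∫ v in (0 : ℝ)..(Real.pi / 2), g (4 * v) =
      ∫ v in (0 : ℝ)..(Real.pi / 2), (ψ₁ (Real.pi / 2 - v) + ψ₂ v) := by
    rw [intervalIntegral.integral_of_le hpi2, intervalIntegral.integral_of_le hpi2,
      integral_Ioc_eq_integral_Ioo, integral_Ioc_eq_integral_Ioo]
    refine setIntegral_congr_fun measurableSet_Ioo fun v hv => ?_
    obtain ⟨hv0, hv1⟩ := hv
    have hs : Real.sin v ≠ 0 := (Real.sin_pos_of_pos_of_lt_pi hv0 (by linarith)).ne'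
    have hc : Real.cos v ≠ 0 := (Real.cos_pos_of_mem_Ioo ⟨by linarith, hv1⟩).ne'
    have hw : Real.pi / 2 - v ≠ 0 := by linarith
    have hcos : Real.cos (2 * (Real.pi / 2 - v)) = -Real.cos (2 * v) := by
      rw [← Real.cos_pi_sub]; congr 1; ring
    simp only [hg, hψ₁, hψ₂]
    rw [Real.sinc_of_ne_zero hv0.ne', Real.sinc_of_ne_zero hw, Real.sin_pi_div_two_sub, hcos,
      show 4 * v / 2 = 2 * v by ring, Real.sin_two_mul]
    have e1 : Real.cos (2 * v) - 1 = -2 * Real.sin v ^ 2 := by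
      rw [Real.cos_two_mul, Real.cos_sq']; ring
    have e2 : Real.cos (2 * v) + 1 = 2 * Real.cos v ^ 2 := by
      rw [Real.cos_two_mul]; ring
    rw [e1, e2]
    have hv' := hv0.ne'
    generalize Real.cos (2 * v) = K
    field_simp
    ring
  rw [hdecomp, intervalIntegral.integral_add c1' c2.intervalIntegrable,
    intervalIntegral.integral_comp_sub_left ψ₁ (Real.pi / 2), sub_self, sub_zero,
    ← intervalIntegral.integral_add c1.intervalIntegrable c2.intervalIntegrable,
    ← intervalIntegral.integral_const_mul]
  refine intervalIntegral.integral_congr fun v _ => ?_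
  simp only [hψ₁, hψ₂]
  rw [← add_div, ← mul_div_assoc]
  congr 1
  field_simp
  ring

/-- The closed form `I = 4π²/3 - (128/π²) ∑ 1/q³`, the sum being over odd `q`. -/
theorem doubleIntegral_eq :
    doubleIntegral = ((4 * Real.pi ^ 2 / 3 - 128 * oddCubeSum / Real.pi ^ 2 : ℝ) : ℂ) := by
  have hpi := Real.pi_pos
  have h1 : ∫ t in Set.Ioi 0, lineIntegral t = ∫ t in Set.Ioo 0 (2 * Real.pi), lineIntegral t := by
    refine setIntegral_eq_of_subset_of_forall_sdiff_eq_zero measurableSet_Ioi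
      (fun t ht => ht.1) fun t ht => lineIntegral_eq_zero ?_
    by_contra hlt
    exact ht.2 ⟨ht.1, not_le.1 hlt⟩
  rw [doubleIntegral_eq_two_mul, h1, setIntegral_congr_fun measurableSet_Ioo
    (fun t ht => lineIntegral_eq ht), ← integral_Ioc_eq_integral_Ioo,
    ← intervalIntegral.integral_of_le (by positivity), intervalIntegral.integral_ofReal,
    integral_line_formula, show (2 : ℂ) = ((2 : ℝ) : ℂ) by norm_num, ← Complex.ofReal_mul]
  congr 1
  field_simp
  ring

theorem constC_eq : constC = Real.exp (oddCubeSum - Real.pi ^ 4 / 96) := by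
  rw [constC, doubleIntegral_eq, Complex.ofReal_re]
  congr 1
  have := Real.pi_ne_zero
  field_simp
  ring

theorem doubleIntegral_re_approx : |doubleIntegral.re - (-0.481436)| ≤ 0.0000005 := by
  rw [doubleIntegral_eq, Complex.ofReal_re]
  obtain ⟨hz1, hz2⟩ := oddCubeSum_bounds
  have h1 : (9.869604401 : ℝ) ≤ Real.pi ^ 2 := by nlinarith [Real.pi_gt_d20]
  have h2 : Real.pi ^ 2 ≤ 9.869604402 := by nlinarith [Real.pi_lt_d20, Real.pi_pos]
  set P := Real.pi ^ 2
  have hP : 0 < P := by linarith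
  have h3 : 128 * oddCubeSum / P ≤ 128 * 1.05179981 / 9.869604401 := by gcongr
  have h4 : 128 * 1.05179977 / 9.869604402 ≤ 128 * oddCubeSum / P := by gcongr
  norm_num at h3 h4
  rw [abs_le]
  constructor <;> linarith

theorem constC_approx : 1 < constC ∧ |constC - 1.0378| ≤ 0.00005 := by
  rw [constC_eq]
  obtain ⟨hz1, hz2⟩ := oddCubeSum_bounds
  have h1 : (9.869604401 : ℝ) ≤ Real.pi ^ 2 := by nlinarith [Real.pi_gt_d20]
  have h2 : Real.pi ^ 2 ≤ 9.869604402 := by nlinarith [Real.pi_lt_d20, Real.pi_pos]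
  have h3 : (9.869604401 : ℝ) ^ 2 ≤ Real.pi ^ 4 := by
    rw [show Real.pi ^ 4 = (Real.pi ^ 2) ^ 2 by ring]; gcongr
  have h4 : Real.pi ^ 4 ≤ (9.869604402 : ℝ) ^ 2 := by
    rw [show Real.pi ^ 4 = (Real.pi ^ 2) ^ 2 by ring]; gcongr
  norm_num at h3 h4
  have hl : 0.037121 ≤ oddCubeSum - Real.pi ^ 4 / 96 := by norm_num at *; linarith
  have hu : oddCubeSum - Real.pi ^ 4 / 96 ≤ 0.037122 := by norm_num at *; linarith
  set e := oddCubeSum - Real.pi ^ 4 / 96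
  have he := Real.quadratic_le_exp_of_nonneg (x := e) (by linarith)
  have he2 := (abs_le.1 (Real.exp_bound (x := e) (by rw [abs_le]; constructor <;> linarith)
    (n := 3) (by norm_num))).2
  rw [abs_of_nonneg (by linarith)] at he2
  norm_num [Finset.sum_range_succ, Nat.factorial] at he2
  have h5 : e ^ 2 ≤ 0.037122 ^ 2 := by gcongr
  have h6 : e ^ 3 ≤ 0.037122 ^ 3 := by gcongr
  have h7 : 0.037121 ^ 2 ≤ e ^ 2 := by gcongr
  norm_num at h5 h6 h7
  refine ⟨by nlinarith, ?_⟩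
  rw [abs_le]
  constructor <;> linarith

/-! ### The asymptotic formula and the lower limit -/

theorem exists_asymptotic_bound :
    ∃ K : ℝ, ∀ n : ℕ, Even n → 2 ≤ n →
      |Delta (config n (cMax n)) / (constC * (n : ℝ) ^ n) - 1| ≤ K / (n : ℝ) := by
  set q : ℕ → ℝ := fun n => |Delta (config n (cMax n)) / (constC * (n : ℝ) ^ n) - 1| with hq
  have hq0 : ∀ n, 0 ≤ q n := fun n => abs_nonneg _
  -- Below `3500` the logarithmic error need not be small; these finitely many `n` only affect `K`.
  refine ⟨7000 + ∑ k ∈ Finset.range 3500, q k * k, fun n hn h2 => ?_⟩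
  have hn0 : (0 : ℝ) < n := by exact_mod_cast (by omega : 0 < n)
  have hS : 0 ≤ ∑ k ∈ Finset.range 3500, q k * k :=
    Finset.sum_nonneg fun k _ => mul_nonneg (hq0 k) (Nat.cast_nonneg k)
  change q n ≤ _
  rw [le_div_iff₀ hn0]
  rcases lt_or_ge n 3500 with hlt | hge
  · have := Finset.single_le_sum (f := fun k : ℕ => q k * k)
      (fun k _ => mul_nonneg (hq0 k) (Nat.cast_nonneg k)) (Finset.mem_range.2 hlt)
    linarith
  · obtain ⟨hpos, hlog⟩ := abs_log_Delta_cMax_sub_le hn (by omega : 20 ≤ n)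
    have hge' : (3500 : ℝ) ≤ n := by exact_mod_cast hge
    set D := Delta (config n (cMax n))
    set x := Real.log (D / (n : ℝ) ^ n) - (oddCubeSum - Real.pi ^ 4 / 96) with hx
    have hx1 : |x| ≤ 1 := hlog.trans (by rw [div_le_one hn0]; exact hge')
    have hratio : D / (constC * (n : ℝ) ^ n) = Real.exp x := by
      rw [hx, Real.exp_sub, Real.exp_log (div_pos hpos (pow_pos hn0 n)), ← constC_eq, div_div, mul_comm]
    have hqn : q n = |Real.exp x - 1| := by rw [← hratio, hq]
    have hexp := Real.abs_exp_sub_one_le hx1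
    have h3 : q n ≤ 7000 / (n : ℝ) := by
      rw [hqn]
      calc _ ≤ 2 * |x| := hexp
        _ ≤ 2 * (3500 / (n : ℝ)) := by gcongr
        _ = _ := by ring
    rw [le_div_iff₀ hn0] at h3
    linarith

theorem constC_pos : 0 < constC := Real.exp_pos _

theorem Delta_cMax_le_deltaMax {n : ℕ} (hn : Even n) (h2 : 2 ≤ n) :
    Delta (config n (cMax n)) ≤ deltaMax n :=
  (isGreatest_deltaMax h2).2 ⟨_, cMax_mem_admissible hn h2, rfl⟩

theorem constC_le_liminf :
    ((constC : ℝ) : EReal) ≤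
      liminf (fun n : ℕ => ((deltaMax n / (n : ℝ) ^ n : ℝ) : EReal))
        (atTop ⊓ 𝓟 {n : ℕ | Even n}) := by
  obtain ⟨K, hK⟩ := exists_asymptotic_bound
  refine le_of_forall_lt fun a ha => ?_
  obtain ⟨b, hab, hb⟩ := EReal.lt_iff_exists_real_btwn.1 ha
  refine hab.trans_le (le_liminf_of_le (by isBoundedDefault) ?_)
  have hlim : Tendsto (fun n : ℕ => constC * (1 - K / (n : ℝ))) atTop (𝓝 (constC * (1 - 0))) :=
    ((tendsto_const_div_atTop_nhds_zero_nat K).const_sub 1).const_mul _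
  rw [sub_zero, mul_one] at hlim
  have hev := hlim.eventually_const_lt (EReal.coe_lt_coe_iff.1 hb)
  rw [eventually_inf_principal]
  filter_upwards [hev, eventually_ge_atTop 2] with n hbn h2 hn
  have hn0 : (0 : ℝ) < n := by exact_mod_cast (by omega : 0 < n)
  have hpow : (0 : ℝ) < (n : ℝ) ^ n := by positivity
  have h1 := (abs_le.1 (hK n hn h2)).1
  have h3 : constC * (1 - K / (n : ℝ)) ≤ Delta (config n (cMax n)) / (n : ℝ) ^ n := by
    have e : Delta (config n (cMax n)) / (n : ℝ) ^ n =
        constC * (Delta (config n (cMax n)) / (constC * (n : ℝ) ^ n)) := by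
      have := constC_pos
      field_simp
    rw [e]
    exact mul_le_mul_of_nonneg_left (by linarith) constC_pos.le
  have h4 : Delta (config n (cMax n)) / (n : ℝ) ^ n ≤ deltaMax n / (n : ℝ) ^ n := by
    gcongr
    exact Delta_cMax_le_deltaMax hn h2
  exact EReal.coe_le_coe_iff.2 (by linarith)

end DiameterTwo

theorem proposition1 :
    -- the largest value of `Δ` exists
    (∀ n : ℕ, 2 ≤ n → IsGreatest (DiameterTwo.deltaValues n) (DiameterTwo.deltaMax n)) ∧
    -- the integral `I` converges, is real and negative, and `I ≈ -0.481436`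
    IntegrableOn (fun p : ℝ × ℝ => DiameterTwo.integrand p.1 p.2)
      (Set.Icc 0 (2 * Real.pi) ×ˢ Set.Icc 0 (2 * Real.pi)) volume ∧
    DiameterTwo.doubleIntegral.im = 0 ∧
    DiameterTwo.doubleIntegral.re < 0 ∧
    |DiameterTwo.doubleIntegral.re - (-0.481436)| ≤ 0.0000005 ∧
    -- `C ≈ 1.0378 > 1`
    1 < DiameterTwo.constC ∧
    |DiameterTwo.constC - 1.0378| ≤ 0.00005 ∧
    -- the lower bound for the limit inferior along even `n`
    ((DiameterTwo.constC : ℝ) : EReal) ≤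
      liminf (fun n : ℕ => ((DiameterTwo.deltaMax n / (n : ℝ) ^ n : ℝ) : EReal))
        (atTop ⊓ 𝓟 {n : ℕ | Even n}) ∧
    -- the explicit construction
    (∀ n : ℕ, Even n → 4 ≤ n →
      IsGreatest (DiameterTwo.admissible n) (DiameterTwo.cMax n)) ∧
    (∀ n : ℕ, Even n → 2 ≤ n →
      Metric.diam (Set.range (DiameterTwo.config n (DiameterTwo.cMax n))) = 2) ∧
    (∃ K : ℝ, ∀ n : ℕ, Even n → 2 ≤ n →
      |DiameterTwo.Delta (DiameterTwo.config n (DiameterTwo.cMax n)) /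
          (DiameterTwo.constC * (n : ℝ) ^ n) - 1| ≤ K / (n : ℝ)) := by
  exact ⟨fun n hn => DiameterTwo.isGreatest_deltaMax hn,
    DiameterTwo.integrableOn_integrand,
    by rw [DiameterTwo.doubleIntegral_eq, Complex.ofReal_im],
    by linarith [(abs_le.1 DiameterTwo.doubleIntegral_re_approx).2],
    DiameterTwo.doubleIntegral_re_approx,
    DiameterTwo.constC_approx.1,
    DiameterTwo.constC_approx.2,
    DiameterTwo.constC_le_liminf,
    fun n hn h4 => DiameterTwo.isGreatest_cMax hn h4,
    fun n hn h2 => DiameterTwo.cMax_mem_admissible hn h2,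
    DiameterTwo.exists_asymptotic_bound⟩
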